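/- Let $X$ be a simplicial set with a single vertex $x$ (that is, $X_0=\{x\}$), let $|X|$ be its geometric realization and let $G=\pi_1(|X|,x)$, where the product $gh$ in $G$ means "first $g$, then $h$". For $a\in X_1$ let $g_a\in G$ be the class of the loop in $|X|$ obtained by traversing the realization of $a$ from its initial to its final vertex. Let $I$ be the augmentation ideal of $\mathbb{Z}G$ and put $D^{(k)}(G)=\mathbb{Z}G/I^k$ for an integer $k\ge 0$. Let $C=C(X)$ be the (unnormalized) integral chain complex of $X$, free on all simplices, with differential $\delta$ and the comultiplication $\Delta\sigma=\sum_{i+j=n}{}_{(i)}\sigma\otimes\sigma_{(j)}$ for an $n$-simplex $\sigma$, where ${}_{(i)}\sigma$ is the front $i$-face and $\sigma_{(j)}$ the back $j$-face of $\sigma$. Let $\bar C=C/C_0$ with the induced differential $\delta$ and comultiplication $\bar\Delta$. Let $\mathcal{F}(C)=T(s^{-1}\bar C)$ be the cobar construction: the tensor algebra on the desuspension of $\bar C$ (so $[c]=s^{-1}c$ has degree $\deg c-1$), graded by total degree, whose differential is the graded derivation with $$\partial[c]=-[\delta c]+\sum_i(-1)^{\deg a_i}[a_i|b_i],\qquad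 \bar\Delta c=\sum_i a_i\otimes b_i .$$ Let $\mathcal{F}^{(k)}(C)=\mathcal{F}(C)/(T^k(s^{-1}\bar C))$ be its quotient by the ideal $\bigoplus_{r\ge k}T^r(s^{-1}\bar C)$, which is a subcomplex, and let $A^{(k)}(X)=H_0(\mathcal{F}^{(k)}(C))$ with its induced ring structure. Then for every $k\ge 0$ there is a ring isomorphism $D^{(k)}(G)\to A^{(k)}(X)$ that, for each $a\in X_1$, sends the image of $g_a$ in $D^{(k)}(G)$ to the class of $1+[a]$ in $A^{(k)}(X)$. -/

import Mathlib

open CategoryTheory Simplicial TensorProduct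

universe u

noncomputable section

namespace CobarPi

/-! ### The quotients `ℤG / I ^ k` of an integral group ring -/

/-- The augmentation ideal of `ℤG`: the kernel of the ring homomorphism `ℤG → ℤ` sending every
`g : G` to `1`. -/
def augIdeal (G : Type u) [Group G] : Ideal (MonoidAlgebra ℤ G) :=
  RingHom.ker (MonoidAlgebra.lift ℤ ℤ G (1 : G →* ℤ))

instance (G : Type u) [Group G] : (augIdeal G).IsTwoSided := by
  unfold augIdeal
  infer_instance

/-- `D^(k)(G) = ℤG / I ^ k`. -/
abbrev DQuot (G : Type u) [Group G] (k : ℕ) : Type u :=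
  MonoidAlgebra ℤ G ⧸ augIdeal G ^ k

/-- The image of a group element in `ℤG / I ^ k`. -/
def DQuot.of {G : Type u} [Group G] (k : ℕ) (g : G) : DQuot G k :=
  Ideal.Quotient.mk (augIdeal G ^ k) (MonoidAlgebra.of ℤ G g)

/-! ### The fundamental group of the geometric realization -/

/-- The fundamental group with the classical convention for products: `g * h` is the class of
"first `g`, then `h`". Mathlib's `FundamentalGroup` has the opposite multiplication
(`p * q = q.trans p`), hence the `ᵐᵒᵖ`. -/
abbrev Pi1 (Y : Type u) [TopologicalSpace Y] (y : Y) : Type u :=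
  (FundamentalGroup Y y)ᵐᵒᵖ

/-- The homotopy class of a loop as an element of the fundamental group. -/
def Pi1.mk {Y : Type u} [TopologicalSpace Y] {y : Y} (p : Path y y) : Pi1 Y y :=
  MulOpposite.op (FundamentalGroup.fromPath (Path.Homotopic.Quotient.mk p))

theorem Pi1.mk_mul_mk {Y : Type u} [TopologicalSpace Y] {y : Y} (p q : Path y y) :
    Pi1.mk p * Pi1.mk q = Pi1.mk (p.trans q) := rfl

/-- The characteristic map of a simplex in the geometric realization. -/
def simplexMap (X : SSet.{u}) {n : ℕ} (σ : X _⦋n⦌) :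
    C(stdSimplex ℝ (Fin (n + 1)), |X|) :=
  TopCat.toSSetObjEquiv |X| _ ((sSetTopAdj.unit.app X).app _ σ)

/-- The point of `|X|` given by a vertex of `X`. -/
def vertexPoint (X : SSet.{u}) (x : X _⦋0⦌) : |X| := simplexMap X x default

theorem simplexMap_δ (X : SSet.{u}) {n : ℕ} (σ : X _⦋n + 1⦌) (i : Fin (n + 2))
    (z : stdSimplex ℝ (Fin (n + 1))) :
    simplexMap X (X.δ i σ) z = simplexMap X σ (stdSimplex.map i.succAbove z) := by
  have h : (sSetTopAdj.unit.app X).app _ (X.δ i σ) =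
      (TopCat.toSSet.obj |X|).δ i ((sSetTopAdj.unit.app X).app _ σ) :=
    SSet.δ_naturality_apply (sSetTopAdj.unit.app X) i σ
  have h' : simplexMap X (X.δ i σ) = TopCat.toSSetObjEquiv |X| _
      ((TopCat.toSSet.obj |X|).δ i ((sSetTopAdj.unit.app X).app _ σ)) :=
    congrArg (TopCat.toSSetObjEquiv |X| (Opposite.op ⦋n⦌)) h
  rw [h', simplexMap]
  exact TopCat.toSSetObjEquiv_δ_apply _ i z

/-- A `1`-simplex `a` gives the path `t ↦ (1 - t) v₀ + t v₁` in `|X|`, running from its initial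
vertex `d₁ a` to its final vertex `d₀ a`. -/
def edgePath (X : SSet.{u}) (a : X _⦋1⦌) :
    Path (vertexPoint X (X.δ 1 a)) (vertexPoint X (X.δ 0 a)) where
  toFun t := simplexMap X a (stdSimplexHomeomorphUnitInterval.symm t)
  continuous_toFun := by fun_prop
  source' := by
    rw [vertexPoint, simplexMap_δ]
    congr 1
    rw [Subsingleton.elim (default : stdSimplex ℝ (Fin (0 + 1))) (stdSimplex.vertex 0),
      stdSimplex.map_vertex, Homeomorph.symm_apply_eq]
    rfl
  target' := by
    rw [vertexPoint, simplexMap_δ]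
    congr 1
    rw [Subsingleton.elim (default : stdSimplex ℝ (Fin (0 + 1))) (stdSimplex.vertex 0),
      stdSimplex.map_vertex, Homeomorph.symm_apply_eq]
    rfl

/-- The element `g_a` of `π₁(|X|, x)` given by a `1`-simplex `a` of a simplicial set `X` with the
single vertex `x`. -/
def edgeClass (X : SSet.{u}) (x : X _⦋0⦌) (hx : ∀ y : X _⦋0⦌, y = x) (a : X _⦋1⦌) :
    Pi1 |X| (vertexPoint X x) :=
  Pi1.mk ((edgePath X a).cast (by rw [hx (X.δ 1 a)]) (by rw [hx (X.δ 0 a)]))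

/-! ### The chain coalgebra of a simplicial set -/

/-- The total module of the (unnormalized) integral chain complex `C(X)`: it is free on the
simplices of all dimensions. -/
abbrev Chains (X : SSet.{u}) : Type u := (Σ n : ℕ, X _⦋n⦌) →₀ ℤ

/-- A simplex as a chain. -/
def simplexChain (X : SSet.{u}) {n : ℕ} (σ : X _⦋n⦌) : Chains X :=
  Finsupp.single ⟨n, σ⟩ 1

/-- The boundary of a simplex. -/
def boundaryOn (X : SSet.{u}) (n : ℕ) : X _⦋n⦌ → Chains X :=
  Nat.casesOn (motive := fun n => X _⦋n⦌ → Chains X) n (fun _ => 0)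
    (fun m σ => ∑ i : Fin (m + 2), (-1 : ℤ) ^ (i : ℕ) • simplexChain X (X.δ i σ))

/-- The differential of `C(X)`. -/
def boundary (X : SSet.{u}) : Chains X →ₗ[ℤ] Chains X :=
  Finsupp.linearCombination ℤ fun s : (Σ n : ℕ, X _⦋n⦌) => boundaryOn X s.1 s.2

/-- The front `p`-dimensional face of an `n`-simplex (vertices `0, …, p`). -/
def frontFace (X : SSet.{u}) {n : ℕ} (σ : X _⦋n⦌) (p : Fin (n + 1)) : X _⦋(p : ℕ)⦌ :=
  X.map (SimplexCategory.subinterval 0 p (by omega)).op σ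

/-- The back `(n - p)`-dimensional face of an `n`-simplex (vertices `p, …, n`). -/
def backFace (X : SSet.{u}) {n : ℕ} (σ : X _⦋n⦌) (p : Fin (n + 1)) : X _⦋n - (p : ℕ)⦌ :=
  X.map (SimplexCategory.subinterval p (n - p) (by omega)).op σ

/-- The Alexander–Whitney comultiplication of `C(X)`. -/
def comul (X : SSet.{u}) : Chains X →ₗ[ℤ] Chains X ⊗[ℤ] Chains X :=
  Finsupp.linearCombination ℤ fun s : (Σ n : ℕ, X _⦋n⦌) =>
    ∑ p : Fin (s.1 + 1), simplexChain X (frontFace X s.2 p) ⊗ₜ[ℤ] simplexChain X (backFace X s.2 p)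

/-- The map multiplying an `n`-chain by `(-1) ^ n`. -/
def chainSign (X : SSet.{u}) : Chains X →ₗ[ℤ] Chains X :=
  Finsupp.linearCombination ℤ fun s : (Σ n : ℕ, X _⦋n⦌) => (-1 : ℤ) ^ s.1 • simplexChain X s.2

/-- The submodule `C₀` of `0`-chains. -/
def zeroChains (X : SSet.{u}) : Submodule ℤ (Chains X) :=
  Submodule.span ℤ (Set.range fun x : X _⦋0⦌ => simplexChain X x)

/-- `C̄ = C / C₀`. -/
abbrev RedChains (X : SSet.{u}) : Type u := Chains X ⧸ zeroChains X

theorem boundary_simplexChain_zero (X : SSet.{u}) (x : X _⦋0⦌) :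
    boundary X (simplexChain X x) = 0 := by
  simp [boundary, simplexChain, boundaryOn]

theorem comul_simplexChain (X : SSet.{u}) {n : ℕ} (σ : X _⦋n⦌) :
    comul X (simplexChain X σ) = ∑ p : Fin (n + 1),
      simplexChain X (frontFace X σ p) ⊗ₜ[ℤ] simplexChain X (backFace X σ p) := by
  simp [comul, simplexChain]

theorem chainSign_simplexChain (X : SSet.{u}) {n : ℕ} (σ : X _⦋n⦌) :
    chainSign X (simplexChain X σ) = (-1 : ℤ) ^ n • simplexChain X σ := by
  simp [chainSign, simplexChain]

/-- The class of a simplex in `C̄`. -/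
def redSimplex (X : SSet.{u}) {n : ℕ} (σ : X _⦋n⦌) : RedChains X :=
  (zeroChains X).mkQ (simplexChain X σ)

theorem redSimplex_zero (X : SSet.{u}) {n : ℕ} (hn : n = 0) (x : X _⦋n⦌) :
    redSimplex X x = 0 := by
  subst hn
  exact (Submodule.Quotient.mk_eq_zero _).2 (Submodule.subset_span ⟨x, rfl⟩)

/-- The differential of `C̄`. -/
def redBoundary (X : SSet.{u}) : RedChains X →ₗ[ℤ] RedChains X :=
  (zeroChains X).mapQ (zeroChains X) (boundary X) <| by
    refine Submodule.span_le.2 ?_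
    rintro _ ⟨x, rfl⟩
    simp [boundary_simplexChain_zero]

/-- The map `(-1) ^ deg` on `C̄`. -/
def redSign (X : SSet.{u}) : RedChains X →ₗ[ℤ] RedChains X :=
  (zeroChains X).mapQ (zeroChains X) (chainSign X) <| by
    refine Submodule.span_le.2 ?_
    rintro _ ⟨x, rfl⟩
    have h : simplexChain X x ∈ zeroChains X := Submodule.subset_span ⟨x, rfl⟩
    simpa [chainSign_simplexChain] using h

/-- The comultiplication of `C̄` induced by that of `C`. -/
def redComul (X : SSet.{u}) : RedChains X →ₗ[ℤ] RedChains X ⊗[ℤ] RedChains X :=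
  (zeroChains X).liftQ
    (TensorProduct.map (zeroChains X).mkQ (zeroChains X).mkQ ∘ₗ comul X) <| by
    refine Submodule.span_le.2 ?_
    rintro _ ⟨x, rfl⟩
    change TensorProduct.map _ _ (comul X (simplexChain X x)) = 0
    rw [comul_simplexChain, map_sum]
    refine Finset.sum_eq_zero fun p _ => ?_
    rw [TensorProduct.map_tmul]
    change redSimplex X _ ⊗ₜ redSimplex X _ = 0
    rw [redSimplex_zero X (by omega), TensorProduct.zero_tmul]

theorem redComul_redSimplex (X : SSet.{u}) {n : ℕ} (σ : X _⦋n⦌) :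
    redComul X (redSimplex X σ) = ∑ p : Fin (n + 1),
      redSimplex X (frontFace X σ p) ⊗ₜ[ℤ] redSimplex X (backFace X σ p) := by
  change TensorProduct.map _ _ (comul X (simplexChain X σ)) = _
  rw [comul_simplexChain, map_sum]
  rfl

theorem redBoundary_redSimplex (X : SSet.{u}) {n : ℕ} (σ : X _⦋n + 1⦌) :
    redBoundary X (redSimplex X σ) =
      ∑ i : Fin (n + 2), (-1 : ℤ) ^ (i : ℕ) • redSimplex X (X.δ i σ) := by
  change (zeroChains X).mkQ (boundary X (simplexChain X σ)) = _
  have h : boundary X (simplexChain X σ) =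
      ∑ i : Fin (n + 2), (-1 : ℤ) ^ (i : ℕ) • simplexChain X (X.δ i σ) := by
    simp [boundary, simplexChain, boundaryOn]
  rw [h, map_sum]
  simp only [map_smul]
  rfl

theorem redSign_redSimplex (X : SSet.{u}) {n : ℕ} (σ : X _⦋n⦌) :
    redSign X (redSimplex X σ) = (-1 : ℤ) ^ n • redSimplex X σ := by
  change (zeroChains X).mkQ (chainSign X (simplexChain X σ)) = _
  rw [chainSign_simplexChain, map_smul]
  rfl

/-! ### The cobar construction -/

/-- The cobar construction `T(s⁻¹ C̄)`. The desuspension `s⁻¹` leaves the module `C̄` unchanged and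
only shifts degrees: `[σ]` has degree `n - 1` for an `n`-simplex `σ`. -/
abbrev Cobar (X : SSet.{u}) : Type u := TensorAlgebra ℤ (RedChains X)

/-- The linear map `c ↦ [c]`. -/
def bracket (X : SSet.{u}) : RedChains X →ₗ[ℤ] Cobar X := TensorAlgebra.ι ℤ

/-- The generator `[σ]` given by a simplex. -/
def gen (X : SSet.{u}) {n : ℕ} (σ : X _⦋n⦌) : Cobar X := bracket X (redSimplex X σ)

/-- The algebra automorphism which is `(-1) ^ n` on elements of degree `n`; on generators it is
`[c] ↦ (-1) ^ (deg c - 1) [c]`. -/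
def cobarSign (X : SSet.{u}) : Cobar X →ₐ[ℤ] Cobar X :=
  TensorAlgebra.lift ℤ (-(bracket X ∘ₗ redSign X))

/-- The differential on generators: `c ↦ -[δ c] + ∑ (-1) ^ deg aᵢ [aᵢ | bᵢ]`, where
`Δ̄ c = ∑ aᵢ ⊗ bᵢ`. -/
def cobarDGen (X : SSet.{u}) : RedChains X →ₗ[ℤ] Cobar X :=
  -(bracket X ∘ₗ redBoundary X) +
    LinearMap.mul' ℤ (Cobar X) ∘ₗ
      TensorProduct.map (bracket X ∘ₗ redSign X) (bracket X) ∘ₗ redComul X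

theorem cobarDGen_apply (X : SSet.{u}) (c : RedChains X) :
    cobarDGen X c = -bracket X (redBoundary X c) + LinearMap.mul' ℤ (Cobar X)
      (TensorProduct.map (bracket X ∘ₗ redSign X) (bracket X) (redComul X c)) := rfl

/-- Auxiliary: the algebra map `u ↦ !![± u, ∂ u; 0, u]`, whose multiplicativity encodes the graded
Leibniz rule for `∂`. -/
def cobarMatrix (X : SSet.{u}) : Cobar X →ₐ[ℤ] Matrix (Fin 2) (Fin 2) (Cobar X) :=
  TensorAlgebra.lift ℤ
    { toFun := fun c => !![cobarSign X (bracket X c), cobarDGen X c; 0, bracket X c]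
      map_add' := fun c c' => by
        ext i j
        fin_cases i <;> fin_cases j <;> simp
      map_smul' := fun r c => by
        ext i j
        fin_cases i <;> fin_cases j <;> simp }

/-- The differential of the cobar construction: the unique graded derivation extending `cobarDGen`
(see `cobarD_bracket` and `cobarD_mul`). -/
def cobarD (X : SSet.{u}) : Cobar X →ₗ[ℤ] Cobar X where
  toFun u := cobarMatrix X u 0 1
  map_add' u v := by simp
  map_smul' r u := by rw [map_smul, Matrix.smul_apply]; rfl

theorem cobarMatrix_bracket (X : SSet.{u}) (c : RedChains X) :
    cobarMatrix X (bracket X c) =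
      !![cobarSign X (bracket X c), cobarDGen X c; 0, bracket X c] := by
  simp [cobarMatrix, bracket]

theorem cobarMatrix_entries (X : SSet.{u}) (u : Cobar X) :
    cobarMatrix X u 0 0 = cobarSign X u ∧ cobarMatrix X u 1 0 = 0 ∧ cobarMatrix X u 1 1 = u := by
  induction u using TensorAlgebra.induction with
  | algebraMap r =>
    rw [AlgHom.commutes, AlgHom.commutes]
    simp only [Matrix.algebraMap_matrix_apply]
    simp
  | ι c =>
    have h := cobarMatrix_bracket X c
    rw [bracket] at h
    simp [h]
  | mul a b ha hb =>
    simp [Matrix.mul_apply, ha.1, ha.2.1, ha.2.2, hb.1, hb.2.1, hb.2.2]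
  | add a b ha hb =>
    simp [ha.1, ha.2.1, ha.2.2, hb.1, hb.2.1, hb.2.2]

theorem cobarD_bracket (X : SSet.{u}) (c : RedChains X) :
    cobarD X (bracket X c) = cobarDGen X c := by
  simp [cobarD, cobarMatrix_bracket]

theorem cobarD_mul (X : SSet.{u}) (u v : Cobar X) :
    cobarD X (u * v) = cobarD X u * v + cobarSign X u * cobarD X v := by
  simp [cobarD, Matrix.mul_apply, (cobarMatrix_entries X u).1, (cobarMatrix_entries X v).2.2,
    add_comm]

theorem cobarD_one (X : SSet.{u}) : cobarD X 1 = 0 := by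
  simp [cobarD]

/-- `∂[σ] = -[δσ] + ∑ₚ (-1) ^ p [ₚσ | σ_{n-p}]`. -/
theorem cobarD_gen (X : SSet.{u}) {n : ℕ} (σ : X _⦋n⦌) :
    cobarD X (gen X σ) = -bracket X (redBoundary X (redSimplex X σ)) +
      ∑ p : Fin (n + 1), (-1 : ℤ) ^ (p : ℕ) • (gen X (frontFace X σ p) * gen X (backFace X σ p)) := by
  rw [gen, cobarD_bracket]
  simp only [cobarDGen_apply, LinearMap.comp_apply,
    redComul_redSimplex, map_sum, TensorProduct.map_tmul, redSign_redSimplex, map_smul,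
    LinearMap.mul'_apply, smul_mul_assoc, gen]

/-- The degree `n` part of the cobar construction: it is spanned by the monomials
`[σ₁ | … | σᵣ]` with `∑ (dim σᵢ - 1) = n`, where all `σᵢ` are of positive dimension. -/
def cobarDegree (X : SSet.{u}) (n : ℕ) : Submodule ℤ (Cobar X) :=
  Submodule.span ℤ {w | ∃ l : List (Σ m : ℕ, X _⦋m + 1⦌),
    (l.map fun s => s.1).sum = n ∧ (l.map fun s => gen X s.2).prod = w}

theorem mul_mem_cobarDegree (X : SSet.{u}) {m n : ℕ} {u v : Cobar X}
    (hu : u ∈ cobarDegree X m) (hv : v ∈ cobarDegree X n) : u * v ∈ cobarDegree X (m + n) := by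
  have h : cobarDegree X m * cobarDegree X n ≤ cobarDegree X (m + n) := by
    unfold cobarDegree
    rw [Submodule.span_mul_span]
    refine Submodule.span_mono ?_
    rintro _ ⟨_, ⟨l, hl, rfl⟩, _, ⟨l', hl', rfl⟩, rfl⟩
    exact ⟨l ++ l', by simp [hl, hl'], by simp⟩
  exact h (Submodule.mul_mem_mul hu hv)

theorem one_mem_cobarDegree (X : SSet.{u}) : (1 : Cobar X) ∈ cobarDegree X 0 :=
  Submodule.subset_span ⟨[], by simp, by simp⟩

theorem gen_mem_cobarDegree (X : SSet.{u}) {n : ℕ} (σ : X _⦋n + 1⦌) :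
    gen X σ ∈ cobarDegree X n :=
  Submodule.subset_span ⟨[⟨n, σ⟩], by simp, by simp⟩

theorem cobarSign_of_mem (X : SSet.{u}) {n : ℕ} {u : Cobar X} (hu : u ∈ cobarDegree X n) :
    cobarSign X u = (-1 : ℤ) ^ n • u := by
  induction hu using Submodule.span_induction with
  | mem w hw =>
    obtain ⟨l, rfl, rfl⟩ := hw
    induction l with
    | nil => simp
    | cons s l ih =>
      have hs : cobarSign X (gen X s.2) = (-1 : ℤ) ^ s.1 • gen X s.2 := by
        have : cobarSign X (gen X s.2) = -bracket X (redSign X (redSimplex X s.2)) := by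
          simp [cobarSign, gen, bracket]
        rw [this, redSign_redSimplex, map_smul, pow_succ]
        simp [gen]
      simp only [List.map_cons, List.prod_cons, List.sum_cons, map_mul, hs, ih, pow_add,
        smul_mul_smul_comm]
  | zero => simp
  | add u v _ _ hu hv => rw [map_add, hu, hv, smul_add]
  | smul r u _ hu => rw [map_smul, hu, smul_comm]

/-! ### Truncation at tensor length `k` -/

/-- The ideal `(T^k(s⁻¹ C̄)) = ⨁_{r ≥ k} T^r(s⁻¹ C̄)` generated by the tensors of length `k`. -/
def lengthIdeal (X : SSet.{u}) (k : ℕ) : Ideal (Cobar X) :=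
  Ideal.span (LinearMap.range (bracket X) ^ k : Submodule ℤ (Cobar X))

theorem mul_bracket_mem (X : SSet.{u}) (k : ℕ) {u : Cobar X} (hu : u ∈ lengthIdeal X k)
    (c : RedChains X) : u * bracket X c ∈ lengthIdeal X k := by
  induction hu using Submodule.span_induction with
  | mem t ht =>
    have h : t * bracket X c ∈ LinearMap.range (bracket X) * LinearMap.range (bracket X) ^ k := by
      rw [← pow_succ', pow_succ]
      exact Submodule.mul_mem_mul ht ⟨c, rfl⟩
    exact Submodule.mul_induction_on h
      (fun m _ n hn => Ideal.mul_mem_left _ _ (Ideal.subset_span hn))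
      (fun x y hx hy => add_mem hx hy)
  | zero => simp
  | add u v _ _ hu hv => rw [add_mul]; exact add_mem hu hv
  | smul a u _ hu => rw [smul_eq_mul, mul_assoc]; exact Ideal.mul_mem_left _ _ hu

instance (X : SSet.{u}) (k : ℕ) : (lengthIdeal X k).IsTwoSided where
  mul_mem_of_left {u} b hu := by
    induction b using TensorAlgebra.induction generalizing u with
    | algebraMap r =>
      rw [← Algebra.commutes]
      exact Ideal.mul_mem_left _ _ hu
    | ι c => exact mul_bracket_mem X k hu c
    | mul a b ha hb => rw [← mul_assoc]; exact hb (ha hu)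
    | add a b ha hb => rw [mul_add]; exact add_mem (ha hu) (hb hu)

theorem bracket_mem_lengthIdeal (X : SSet.{u}) (c : RedChains X) :
    bracket X c ∈ lengthIdeal X 1 :=
  Ideal.subset_span (by simp)

theorem mul_mem_lengthIdeal (X : SSet.{u}) (k : ℕ) {u t : Cobar X} (hu : u ∈ lengthIdeal X 1)
    (ht : t ∈ LinearMap.range (bracket X) ^ k) : u * t ∈ lengthIdeal X (k + 1) := by
  induction hu using Submodule.span_induction with
  | mem s hs =>
    refine Ideal.subset_span ?_
    rw [pow_one] at hs
    rw [pow_succ']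
    exact Submodule.mul_mem_mul hs ht
  | zero => simp
  | add u v _ _ hu hv => rw [add_mul]; exact add_mem hu hv
  | smul a u _ hu => rw [smul_eq_mul, mul_assoc]; exact Ideal.mul_mem_left _ _ hu

theorem bracket_mul_mem_lengthIdeal (X : SSet.{u}) (k : ℕ) (c : RedChains X) {u : Cobar X}
    (hu : u ∈ lengthIdeal X k) : bracket X c * u ∈ lengthIdeal X (k + 1) := by
  have key : ∀ v ∈ lengthIdeal X 1, v * u ∈ lengthIdeal X (k + 1) := by
    induction hu using Submodule.span_induction with
    | mem t ht => exact fun v hv => mul_mem_lengthIdeal X k hv ht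
    | zero => simp
    | add u v _ _ hu hv => exact fun w hw => by rw [mul_add]; exact add_mem (hu w hw) (hv w hw)
    | smul a u _ hu =>
      exact fun w hw => by
        rw [smul_eq_mul, ← mul_assoc]
        exact hu _ (Ideal.mul_mem_right _ _ hw)
  exact key _ (bracket_mem_lengthIdeal X c)

theorem cobarDGen_mem_lengthIdeal (X : SSet.{u}) (c : RedChains X) :
    cobarDGen X c ∈ lengthIdeal X 1 := by
  have h : ∀ t : RedChains X ⊗[ℤ] RedChains X, LinearMap.mul' ℤ (Cobar X)
      (TensorProduct.map (bracket X ∘ₗ redSign X) (bracket X) t) ∈ lengthIdeal X 1 := by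
    intro t
    induction t using TensorProduct.induction_on with
    | zero => simp
    | tmul a b =>
      simp only [TensorProduct.map_tmul, LinearMap.mul'_apply]
      exact Ideal.mul_mem_left _ _ (bracket_mem_lengthIdeal X b)
    | add s t hs ht => simp only [map_add]; exact add_mem hs ht
  exact add_mem (neg_mem (bracket_mem_lengthIdeal X _)) (h _)

theorem cobarD_mem_lengthIdeal (X : SSet.{u}) (k : ℕ) {u : Cobar X} (hu : u ∈ lengthIdeal X k) :
    cobarD X u ∈ lengthIdeal X k := by
  have key : ∀ t ∈ LinearMap.range (bracket X) ^ k, cobarD X t ∈ lengthIdeal X k := by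
    clear hu u
    induction k with
    | zero =>
      intro t _
      have h : (1 : Cobar X) ∈ lengthIdeal X 0 := by
        refine Ideal.subset_span ?_
        rw [pow_zero]
        exact Submodule.one_le.1 le_rfl
      simpa using Ideal.mul_mem_left _ (cobarD X t) h
    | succ k ih =>
      intro t ht
      rw [pow_succ'] at ht
      induction ht using Submodule.mul_induction_on' with
      | mem_mul_mem m hm n hn =>
        obtain ⟨c, rfl⟩ := hm
        rw [cobarD_mul, cobarD_bracket]
        refine add_mem (mul_mem_lengthIdeal X k (cobarDGen_mem_lengthIdeal X c) hn) ?_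
        have hc : cobarSign X (bracket X c) = bracket X (-redSign X c) := by
          simp [cobarSign, bracket]
        rw [hc]
        exact bracket_mul_mem_lengthIdeal X k _ (ih n hn)
      | add x _ y _ hx hy => rw [map_add]; exact add_mem hx hy
  induction hu using Submodule.span_induction with
  | mem t ht => exact key t ht
  | zero => simp
  | add u v _ _ hu hv => rw [map_add]; exact add_mem hu hv
  | smul a u hu' hu =>
    rw [smul_eq_mul, cobarD_mul]
    exact add_mem (Ideal.mul_mem_left _ _ hu') (Ideal.mul_mem_left _ _ hu)

/-- The truncated cobar construction `F^(k) = T(s⁻¹ C̄) / (T^k(s⁻¹ C̄))`. -/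
abbrev TruncCobar (X : SSet.{u}) (k : ℕ) : Type u := Cobar X ⧸ lengthIdeal X k

/-- The projection onto the truncated cobar construction. -/
def toTrunc (X : SSet.{u}) (k : ℕ) : Cobar X →+* TruncCobar X k :=
  Ideal.Quotient.mk (lengthIdeal X k)

/-- The differential of the truncated cobar construction. -/
def truncD (X : SSet.{u}) (k : ℕ) : TruncCobar X k →+ TruncCobar X k :=
  QuotientAddGroup.lift (lengthIdeal X k).toAddSubgroup
    ((toTrunc X k).toAddMonoidHom.comp (cobarD X).toAddMonoidHom)
    (fun _ hu => Ideal.Quotient.eq_zero_iff_mem.2 (cobarD_mem_lengthIdeal X k hu))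

theorem truncD_toTrunc (X : SSet.{u}) (k : ℕ) (u : Cobar X) :
    truncD X k (toTrunc X k u) = toTrunc X k (cobarD X u) := rfl

/-- The degree `n` part of the truncated cobar construction. -/
def truncDegree (X : SSet.{u}) (k n : ℕ) : AddSubgroup (TruncCobar X k) :=
  (cobarDegree X n).toAddSubgroup.map (toTrunc X k).toAddMonoidHom

theorem toTrunc_mem (X : SSet.{u}) (k : ℕ) {n : ℕ} {u : Cobar X} (hu : u ∈ cobarDegree X n) :
    toTrunc X k u ∈ truncDegree X k n := ⟨u, hu, rfl⟩

/-! ### Homology in degree `0` -/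

theorem truncD_mul_of_degree_zero (X : SSet.{u}) (k : ℕ) {z w : TruncCobar X k}
    (hz : z ∈ truncDegree X k 0) :
    truncD X k (z * w) = truncD X k z * w + z * truncD X k w := by
  obtain ⟨u, hu, rfl⟩ := hz
  obtain ⟨v, rfl⟩ := Ideal.Quotient.mk_surjective w
  change truncD X k (toTrunc X k u * toTrunc X k v) =
    truncD X k (toTrunc X k u) * toTrunc X k v + toTrunc X k u * truncD X k (toTrunc X k v)
  rw [← map_mul, truncD_toTrunc, truncD_toTrunc, truncD_toTrunc, cobarD_mul, cobarSign_of_mem X hu]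
  simp

theorem truncD_mul_cycle (X : SSet.{u}) (k : ℕ) {z w : TruncCobar X k}
    (hw : truncD X k w = 0) : truncD X k (z * w) = truncD X k z * w := by
  obtain ⟨u, rfl⟩ := Ideal.Quotient.mk_surjective z
  obtain ⟨v, rfl⟩ := Ideal.Quotient.mk_surjective w
  change truncD X k (toTrunc X k v) = 0 at hw
  change truncD X k (toTrunc X k u * toTrunc X k v) = truncD X k (toTrunc X k u) * toTrunc X k v
  rw [truncD_toTrunc] at hw
  rw [← map_mul, truncD_toTrunc, truncD_toTrunc, cobarD_mul, map_add, map_mul, map_mul, hw,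
    mul_zero, add_zero]

theorem mul_mem_truncDegree (X : SSet.{u}) (k : ℕ) {m n : ℕ} {z w : TruncCobar X k}
    (hz : z ∈ truncDegree X k m) (hw : w ∈ truncDegree X k n) :
    z * w ∈ truncDegree X k (m + n) := by
  obtain ⟨u, hu, rfl⟩ := hz
  obtain ⟨v, hv, rfl⟩ := hw
  exact ⟨u * v, mul_mem_cobarDegree X hu hv, map_mul (toTrunc X k) u v⟩

theorem one_mem_truncDegree (X : SSet.{u}) (k : ℕ) :
    (1 : TruncCobar X k) ∈ truncDegree X k 0 := by
  have h := toTrunc_mem X k (one_mem_cobarDegree X)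
  rwa [map_one] at h

theorem truncD_one (X : SSet.{u}) (k : ℕ) : truncD X k 1 = 0 := by
  have h := truncD_toTrunc X k 1
  rwa [map_one, cobarD_one, map_zero] at h

/-- The ring of `0`-cycles of the truncated cobar construction. -/
def zeroCycles (X : SSet.{u}) (k : ℕ) : Subring (TruncCobar X k) where
  carrier := {z | z ∈ truncDegree X k 0 ∧ truncD X k z = 0}
  mul_mem' {z w} hz hw :=
    ⟨by simpa using mul_mem_truncDegree X k hz.1 hw.1, by
      rw [truncD_mul_of_degree_zero X k hz.1, hz.2, hw.2, zero_mul, mul_zero, add_zero]⟩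
  one_mem' := ⟨one_mem_truncDegree X k, truncD_one X k⟩
  add_mem' hz hw := ⟨add_mem hz.1 hw.1, by rw [map_add, hz.2, hw.2, add_zero]⟩
  zero_mem' := ⟨zero_mem _, map_zero _⟩
  neg_mem' hz := ⟨neg_mem hz.1, by rw [map_neg, hz.2, neg_zero]⟩

/-- The two-sided ideal of `0`-boundaries in the ring of `0`-cycles. -/
def zeroBoundaries (X : SSet.{u}) (k : ℕ) : Ideal (zeroCycles X k) where
  carrier := {z | ∃ w ∈ truncDegree X k 1, truncD X k w = z}
  add_mem' := by
    rintro _ _ ⟨w, hw, h⟩ ⟨w', hw', h'⟩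
    exact ⟨w + w', add_mem hw hw', by rw [map_add, h, h']; rfl⟩
  zero_mem' := ⟨0, zero_mem _, map_zero _⟩
  smul_mem' := by
    rintro c _ ⟨w, hw, h⟩
    refine ⟨c * w, by simpa using mul_mem_truncDegree X k c.2.1 hw, ?_⟩
    rw [truncD_mul_of_degree_zero X k c.2.1, c.2.2, zero_mul, zero_add, h]
    rfl

instance (X : SSet.{u}) (k : ℕ) : (zeroBoundaries X k).IsTwoSided where
  mul_mem_of_left := by
    rintro _ c ⟨w, hw, h⟩
    refine ⟨w * c, by simpa using mul_mem_truncDegree X k hw c.2.1, ?_⟩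
    rw [truncD_mul_cycle X k c.2.2, h]
    rfl

/-- The ring `A^(k)(X) = H₀(F^(k))`. -/
abbrev AQuot (X : SSet.{u}) (k : ℕ) : Type u := zeroCycles X k ⧸ zeroBoundaries X k

theorem cobarD_gen_edge (X : SSet.{u}) (a : X _⦋1⦌) : cobarD X (gen X a) = 0 := by
  rw [cobarD_gen, redBoundary_redSimplex]
  simp [Fin.sum_univ_two, gen, redSimplex_zero X rfl (X.δ 0 a), redSimplex_zero X rfl (X.δ 1 a),
    redSimplex_zero X rfl (frontFace X a 0), redSimplex_zero X rfl (backFace X a 1)]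

/-- The `0`-cycle `1 + [a]`, for a `1`-simplex `a`. -/
def oneAddEdge (X : SSet.{u}) (k : ℕ) (a : X _⦋1⦌) : zeroCycles X k :=
  ⟨toTrunc X k (1 + gen X a),
    toTrunc_mem X k (add_mem (one_mem_cobarDegree X) (gen_mem_cobarDegree X a)), by
      rw [truncD_toTrunc, map_add, cobarD_one, cobarD_gen_edge, add_zero, map_zero]⟩

/-- The homology class of a `0`-cycle. -/
def AQuot.mk (X : SSet.{u}) (k : ℕ) (z : zeroCycles X k) : AQuot X k :=
  Ideal.Quotient.mk (zeroBoundaries X k) z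

end CobarPi

end

/-!
An edge `a` acts on `A^(k)(X)` through the unit `1 + [a]`, and the differential of a triangle shows
that these units satisfy the same relations as the classes `g_a`. So the theorem amounts to a
presentation of `π₁(|X|)` by the edges and the triangles, which is proved without van Kampen's
theorem, in two halves.

*The edges satisfy no further relations.* Let `φ` be a function on the edges with values in a group
`H` which is multiplicative on triangles. Encode a point of a simplex by the step function on the
unit interval whose steps have the barycentric coordinates as lengths, and replace the vertex `i` by
the value of `φ` on the edge from the vertex `0` to `i`. The step functions with values in `H`, with
the measure of the set where two of them differ as distance, are acted on by `H` by translation, and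
they cover the quotient by this action. The developed simplices glue to a map from `|X|` to that
quotient, and the monodromy of the covering is a homomorphism from `π₁(|X|)` to `H` extending `φ`.

*The edges generate.* A path is compact, hence lies in a finite skeleton. Away from the centers of
the cells of top dimension it is pushed into a smaller skeleton, and near the centers it stays
inside of a single simplex. So every path is, up to homotopy, a product of paths inside of
simplices, and a path inside of a simplex is a loop from edges followed by a standard path.

A homomorphism from `ℤG` sends `I^k` to `0` if it kills all `k`-fold products of elements `g_a - 1`,
and these become the words `[a₁|⋯|a_k]`, which are `0` in `F^(k)`. Conversely `[a] ↦ g_a - 1` kills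
the boundaries and sends words of length `k` to `I^k`. The two homomorphisms are inverse to each
other on the generators.
-/

noncomputable section

namespace CobarPi

section Realization

variable {X : SSet.{u}}

theorem app_map_op {Z : SSet.{u}} (η : X ⟶ Z) {m n : ℕ} (f : ⦋m⦌ ⟶ ⦋n⦌) (σ : X _⦋n⦌) :
    η.app _ (X.map f.op σ) = Z.map f.op (η.app _ σ) :=
  NatTrans.naturality_apply η f.op σ

theorem simplexMap_map {m n : ℕ} (f : ⦋m⦌ ⟶ ⦋n⦌) (σ : X _⦋n⦌)
    (z : stdSimplex ℝ (Fin (m + 1))) :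
    simplexMap X (X.map f.op σ) z = simplexMap X σ (stdSimplex.map f z) := by
  have naturality : (sSetTopAdj.unit.app X).app _ (X.map f.op σ) =
      (TopCat.toSSet.obj |X|).map f.op ((sSetTopAdj.unit.app X).app _ σ) :=
    app_map_op (sSetTopAdj.unit.app X) f σ
  have simplexMap_eq : simplexMap X (X.map f.op σ) = TopCat.toSSetObjEquiv |X| _
      ((TopCat.toSSet.obj |X|).map f.op ((sSetTopAdj.unit.app X).app _ σ)) :=
    congrArg (TopCat.toSSetObjEquiv |X| (Opposite.op ⦋m⦌)) naturality
  rw [simplexMap_eq]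
  exact TopCat.toSSetObjEquiv_naturality_apply f _ z

/-- A family of maps from the geometric simplices of `X` to `T` is compatible if it respects all
simplicial operators; such families are the cocones under the simplices of `|X|`. -/
def IsCompatible {T : Type*} (F : ∀ n : ℕ, X _⦋n⦌ → stdSimplex ℝ (Fin (n + 1)) → T) : Prop :=
  ∀ ⦃m n : ℕ⦄ (f : ⦋m⦌ ⟶ ⦋n⦌) (σ : X _⦋n⦌) (z : stdSimplex ℝ (Fin (m + 1))),
    F m (X.map f.op σ) z = F n σ (stdSimplex.map f z)

theorem IsCompatible.exists_continuousMap {T : Type u} [TopologicalSpace T]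
    {F : ∀ n : ℕ, X _⦋n⦌ → stdSimplex ℝ (Fin (n + 1)) → T} (hF : IsCompatible F)
    (hcont : ∀ (n : ℕ) (σ : X _⦋n⦌), Continuous (F n σ)) :
    ∃ g : C(|X|, T), ∀ (n : ℕ) (σ : X _⦋n⦌) (z : stdSimplex ℝ (Fin (n + 1))),
      g (simplexMap X σ z) = F n σ z := by
  let φ : X ⟶ TopCat.toSSet.obj (TopCat.of T) :=
    { app := fun n => ↾fun σ =>
        (TopCat.toSSetObjEquiv (TopCat.of T) n).symm ⟨F n.unop.len σ, hcont _ σ⟩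
      naturality := fun n m f => by
        ext σ
        refine (TopCat.toSSetObjEquiv (TopCat.of T) m).injective ?_
        ext z
        exact hF f.unop σ z }
  have unit_comp : sSetTopAdj.unit.app X ≫
      TopCat.toSSet.map ((sSetTopAdj.homEquiv X (TopCat.of T)).symm φ) = φ :=
    (Adjunction.homEquiv_unit ..).symm.trans (Equiv.apply_symm_apply ..)
  refine ⟨((sSetTopAdj.homEquiv X (TopCat.of T)).symm φ).hom, fun n σ z => ?_⟩
  exact congrArg (fun ψ : X ⟶ TopCat.toSSet.obj (TopCat.of T) =>
    TopCat.toSSetObjEquiv (TopCat.of T) (Opposite.op ⦋n⦌) (ψ.app _ σ) z) unit_comp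

theorem IsCompatible.exists_map {T : Type u}
    {F : ∀ n : ℕ, X _⦋n⦌ → stdSimplex ℝ (Fin (n + 1)) → T} (hF : IsCompatible F) :
    ∃ g : |X| → T, ∀ (n : ℕ) (σ : X _⦋n⦌) (z : stdSimplex ℝ (Fin (n + 1))),
      g (simplexMap X σ z) = F n σ z := by
  let : TopologicalSpace T := ⊤
  obtain ⟨g, hg⟩ := hF.exists_continuousMap fun _ _ => continuous_top
  exact ⟨g, hg⟩

theorem continuousMap_ext_simplexMap {T : Type u} [TopologicalSpace T] {g h : C(|X|, T)}
    (H : ∀ (n : ℕ) (σ : X _⦋n⦌) (z : stdSimplex ℝ (Fin (n + 1))),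
      g (simplexMap X σ z) = h (simplexMap X σ z)) : g = h := by
  have ofHom_eq : (TopCat.ofHom g : |X| ⟶ TopCat.of T) = TopCat.ofHom h := by
    apply (sSetTopAdj.homEquiv X (TopCat.of T)).injective
    rw [Adjunction.homEquiv_unit, Adjunction.homEquiv_unit]
    ext n σ
    refine (TopCat.toSSetObjEquiv (TopCat.of T) n).injective ?_
    ext z
    exact H n.unop.len σ z
  exact congrArg TopCat.Hom.hom ofHom_eq

theorem exists_simplexMap_eq (y : |X|) :
    ∃ (n : ℕ) (σ : X _⦋n⦌) (z : stdSimplex ℝ (Fin (n + 1))), simplexMap X σ z = y := by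
  let Covered := {y : |X| // ∃ (n : ℕ) (σ : X _⦋n⦌) (z : stdSimplex ℝ (Fin (n + 1))),
    simplexMap X σ z = y}
  obtain ⟨g, hg⟩ := IsCompatible.exists_continuousMap (T := Covered)
    (F := fun n σ z => ⟨simplexMap X σ z, n, σ, z, rfl⟩)
    (fun _ _ f σ z => Subtype.ext (simplexMap_map f σ z)) (fun n σ => by fun_prop)
  have retraction : (⟨Subtype.val, continuous_subtype_val⟩ : C(Covered, |X|)).comp g = .id _ :=
    continuousMap_ext_simplexMap fun n σ z => congrArg Subtype.val (hg n σ z)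
  have val_g : (g y).val = y := DFunLike.congr_fun retraction y
  exact val_g ▸ (g y).2

theorem continuous_iff_comp_simplexMap {T : Type u} [TopologicalSpace T] {g : |X| → T} :
    Continuous g ↔ ∀ (n : ℕ) (σ : X _⦋n⦌), Continuous (g ∘ simplexMap X σ) := by
  refine ⟨fun hg n σ => hg.comp (simplexMap X σ).continuous, fun hg => ?_⟩
  obtain ⟨g', hg'⟩ := IsCompatible.exists_continuousMap (F := fun n σ => g ∘ simplexMap X σ)
    (fun _ _ f σ z => congrArg g (simplexMap_map f σ z)) hg
  convert g'.continuous using 1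
  ext y
  obtain ⟨n, σ, z, rfl⟩ := exists_simplexMap_eq y
  exact (hg' n σ z).symm

theorem isOpen_iff_preimage_simplexMap {U : Set |X|} :
    IsOpen U ↔ ∀ (n : ℕ) (σ : X _⦋n⦌), IsOpen (simplexMap X σ ⁻¹' U) := by
  simp only [isOpen_iff_continuous_mem,
    ← (Homeomorph.ulift.{u} (X := Prop)).symm.comp_continuous_iff]
  exact continuous_iff_comp_simplexMap

theorem isClosed_iff_preimage_simplexMap {A : Set |X|} :
    IsClosed A ↔ ∀ (n : ℕ) (σ : X _⦋n⦌), IsClosed (simplexMap X σ ⁻¹' A) := by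
  simp only [← isOpen_compl_iff, ← Set.preimage_compl]
  exact isOpen_iff_preimage_simplexMap

end Realization

theorem sum_stdSimplex_map {α β : Type*} [Fintype α] [Fintype β] [DecidableEq β] (f : α → β)
    (v : stdSimplex ℝ α) (s : Finset β) :
    ∑ b ∈ s, stdSimplex.map f v b = ∑ a with f a ∈ s, v a := by
  simp only [stdSimplex.map_coe, FunOnFinite.linearMap_apply_apply]
  exact Finset.sum_fiberwise_eq_sum_filter Finset.univ s f v

theorem continuous_stdSimplex_apply {ι : Type*} [Fintype ι] (i : ι) :
    Continuous fun v : stdSimplex ℝ ι => v i :=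
  (continuous_apply i).comp continuous_subtype_val

theorem sum_stdSimplex_le_one {ι : Type*} [Fintype ι] (v : stdSimplex ℝ ι) (s : Finset ι) :
    ∑ i ∈ s, v i ≤ 1 := by
  rw [← stdSimplex.sum_eq_one v]
  exact Finset.sum_le_univ_sum_of_nonneg v.2.1

section Quantile

variable {ι κ : Type*} [Fintype ι] [LinearOrder ι] [Fintype κ] [LinearOrder κ]

theorem exists_lt_sum_le (v : stdSimplex ℝ ι) (r : Set.Ico (0 : ℝ) 1) :
    ({j | (r : ℝ) < ∑ i with i ≤ j, v i} : Finset ι).Nonempty := by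
  have univ_nonempty : (Finset.univ : Finset ι).Nonempty := by
    by_contra h
    have := stdSimplex.sum_eq_one v
    simp [Finset.not_nonempty_iff_eq_empty.1 h] at this
  refine ⟨Finset.univ.max' univ_nonempty, ?_⟩
  simp only [Finset.mem_filter, Finset.mem_univ, true_and, Finset.le_max', Finset.filter_true,
    stdSimplex.sum_eq_one]
  exact r.2.2

/-- The quantile function of a point of a simplex, regarded as a probability distribution on its
vertices: for `ι = Fin (n + 1)` it takes the values `0, …, n` on consecutive intervals of lengths
`v 0, …, v n`. -/
def quantile (v : stdSimplex ℝ ι) (r : Set.Ico (0 : ℝ) 1) : ι :=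
  ({j | (r : ℝ) < ∑ i with i ≤ j, v i} : Finset ι).min' (exists_lt_sum_le v r)

theorem quantile_mem_iff (v : stdSimplex ℝ ι) (r : Set.Ico (0 : ℝ) 1) {s : Finset ι}
    (hs : IsLowerSet (s : Set ι)) : quantile v r ∈ s ↔ (r : ℝ) < ∑ i ∈ s, v i := by
  have lt_sum_quantile : (r : ℝ) < ∑ i with i ≤ quantile v r, v i :=
    (Finset.mem_filter.1 (Finset.min'_mem _ (exists_lt_sum_le v r))).2
  refine ⟨fun hq => lt_sum_quantile.trans_le ?_, fun hr => ?_⟩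
  · refine Finset.sum_le_sum_of_subset_of_nonneg (fun i hi => ?_) fun i _ _ => v.2.1 i
    exact hs (Finset.mem_filter.1 hi).2 hq
  · have s_nonempty : s.Nonempty := by
      by_contra h
      rw [Finset.not_nonempty_iff_eq_empty.1 h, Finset.sum_empty] at hr
      exact hr.not_ge r.2.1
    refine hs (Finset.min'_le _ _ ?_) (s.max'_mem s_nonempty)
    refine Finset.mem_filter.2 ⟨Finset.mem_univ _, hr.trans_le ?_⟩
    refine Finset.sum_le_sum_of_subset_of_nonneg (fun i hi => ?_) fun i _ _ => v.2.1 i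
    exact Finset.mem_filter.2 ⟨Finset.mem_univ _, s.le_max' i hi⟩

theorem isLowerSet_filter_le (j : ι) : IsLowerSet (({i | i ≤ j} : Finset ι) : Set ι) := by
  simpa only [Finset.coe_filter, Finset.mem_univ, true_and, Set.Iic] using isLowerSet_Iic j

theorem isLowerSet_filter_lt (j : ι) : IsLowerSet (({i | i < j} : Finset ι) : Set ι) := by
  simpa only [Finset.coe_filter, Finset.mem_univ, true_and, Set.Iio] using isLowerSet_Iio j

theorem quantile_le_iff (v : stdSimplex ℝ ι) (r : Set.Ico (0 : ℝ) 1) (j : ι) :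
    quantile v r ≤ j ↔ (r : ℝ) < ∑ i with i ≤ j, v i := by
  simpa using quantile_mem_iff v r (isLowerSet_filter_le j)

theorem quantile_lt_iff (v : stdSimplex ℝ ι) (r : Set.Ico (0 : ℝ) 1) (j : ι) :
    quantile v r < j ↔ (r : ℝ) < ∑ i with i < j, v i := by
  simpa using quantile_mem_iff v r (isLowerSet_filter_lt j)

theorem quantile_map (f : ι →o κ) (v : stdSimplex ℝ ι) (r : Set.Ico (0 : ℝ) 1) :
    quantile (stdSimplex.map f v) r = f (quantile v r) := by
  refine eq_of_forall_ge_iff fun j => ?_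
  rw [quantile_le_iff, sum_stdSimplex_map]
  have isLowerSet_preimage : IsLowerSet (({i | f i ≤ j} : Finset ι) : Set ι) := by
    intro a b hba ha
    simp only [Finset.coe_filter, Finset.mem_univ, true_and, Set.mem_ofPred_eq] at ha ⊢
    exact (f.monotone hba).trans ha
  simpa using (quantile_mem_iff v r isLowerSet_preimage).symm

theorem quantile_vertex (i : ι) (r : Set.Ico (0 : ℝ) 1) : quantile (stdSimplex.vertex i) r = i := by
  simpa using quantile_map (OrderHom.const ι i) (stdSimplex.vertex i) r

theorem exists_mem_uIcc_of_quantile_ne {v w : stdSimplex ℝ ι} {r : Set.Ico (0 : ℝ) 1}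
    (h : quantile v r ≠ quantile w r) :
    ∃ j, (r : ℝ) ∈ Set.uIcc (∑ i with i ≤ j, v i) (∑ i with i ≤ j, w i) := by
  have lt_sum (v : stdSimplex ℝ ι) := (quantile_le_iff v r _).1 le_rfl
  rcases lt_or_gt_of_ne h with h | h
  · refine ⟨_, Set.mem_uIcc.2 (Or.inr ⟨?_, (lt_sum v).le⟩)⟩
    exact not_lt.1 fun hr => ((quantile_le_iff w r _).2 hr).not_gt h
  · refine ⟨_, Set.mem_uIcc.2 (Or.inl ⟨?_, (lt_sum w).le⟩)⟩
    exact not_lt.1 fun hr => ((quantile_le_iff v r _).2 hr).not_gt h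

theorem monotone_quantile (v : stdSimplex ℝ ι) : Monotone (quantile v) := fun r r' hr =>
  (quantile_le_iff v r _).2 (lt_of_le_of_lt hr ((quantile_le_iff v r' _).1 le_rfl))

theorem sum_filter_le (v : ι → ℝ) (j : ι) : ∑ i with i ≤ j, v i = (∑ i with i < j, v i) + v j := by
  rw [add_comm, ← Finset.sum_insert (by simp)]
  congr 1
  ext i
  simp [le_iff_eq_or_lt]

theorem surjective_quantile {v : stdSimplex ℝ ι} (hv : ∀ i, 0 < v i) :
    Function.Surjective (quantile v) := fun j => by
  have sum_le_eq := sum_filter_le v j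
  refine ⟨⟨∑ i with i < j, v i, Finset.sum_nonneg fun i _ => v.2.1 i, ?_⟩, le_antisymm ?_ ?_⟩
  · linarith [hv j, sum_stdSimplex_le_one v {i | i ≤ j}]
  · exact (quantile_le_iff v _ j).2 (by linarith [hv j])
  · rw [← not_lt, quantile_lt_iff]
    exact lt_irrefl _

theorem sum_le_sum_of_quantile_eq {v w : stdSimplex ℝ ι} (h : quantile v = quantile w)
    {s : Finset ι} (hs : IsLowerSet (s : Set ι)) : ∑ i ∈ s, v i ≤ ∑ i ∈ s, w i := by
  by_contra! hlt
  let r : Set.Ico (0 : ℝ) 1 := ⟨∑ i ∈ s, w i, Finset.sum_nonneg fun i _ => w.2.1 i,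
    hlt.trans_le (sum_stdSimplex_le_one v s)⟩
  have quantile_mem : quantile v r ∈ s := (quantile_mem_iff v r hs).2 hlt
  rw [h, quantile_mem_iff w r hs] at quantile_mem
  exact lt_irrefl _ quantile_mem

theorem injective_quantile :
    Function.Injective (quantile : stdSimplex ℝ ι → Set.Ico (0 : ℝ) 1 → ι) := by
  intro v w h
  refine stdSimplex.ext (funext fun j => ?_)
  have sum_eq {s : Finset ι} (hs : IsLowerSet (s : Set ι)) : ∑ i ∈ s, v i = ∑ i ∈ s, w i :=
    le_antisymm (sum_le_sum_of_quantile_eq h hs) (sum_le_sum_of_quantile_eq h.symm hs)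
  have sum_le_eq := sum_eq (isLowerSet_filter_le j)
  have sum_lt_eq := sum_eq (isLowerSet_filter_lt j)
  rw [sum_filter_le, sum_filter_le, sum_lt_eq] at sum_le_eq
  exact add_left_cancel sum_le_eq

end Quantile

section NormalForm

variable {X : SSet.{u}}

/-- The simplicial operator sampling the quantile function of a point of a simplex along a chain of
parameters. Applying it to a simplex turns points of `|X|` into simplices of `X`. -/
def sampleHom {n k : ℕ} (v : stdSimplex ℝ (Fin (n + 1)))
    (A : Fin (k + 1) →o Set.Ico (0 : ℝ) 1) : ⦋k⦌ ⟶ ⦋n⦌ :=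
  SimplexCategory.mkHom ((⟨quantile v, monotone_quantile v⟩ : Set.Ico (0 : ℝ) 1 →o _).comp A)

theorem sampleHom_apply {n k : ℕ} (v : stdSimplex ℝ (Fin (n + 1)))
    (A : Fin (k + 1) →o Set.Ico (0 : ℝ) 1) (i : Fin (k + 1)) :
    sampleHom v A i = quantile v (A i) := rfl

theorem sampleHom_map {m n k : ℕ} (f : ⦋m⦌ ⟶ ⦋n⦌) (v : stdSimplex ℝ (Fin (m + 1)))
    (A : Fin (k + 1) →o Set.Ico (0 : ℝ) 1) :
    sampleHom (stdSimplex.map f v) A = sampleHom v A ≫ f := by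
  ext i : 3
  exact quantile_map f.toOrderHom v (A i)

theorem map_sampleHom_eq {m n : ℕ} {σ : X _⦋m⦌} {τ : X _⦋n⦌}
    {v : stdSimplex ℝ (Fin (m + 1))} {w : stdSimplex ℝ (Fin (n + 1))}
    (h : simplexMap X σ v = simplexMap X τ w) {k : ℕ} (A : Fin (k + 1) →o Set.Ico (0 : ℝ) 1) :
    X.map (sampleHom v A).op σ = X.map (sampleHom w A).op τ := by
  have compatible : IsCompatible fun n (σ : X _⦋n⦌) v => X.map (sampleHom v A).op σ :=
    fun m n f σ z => by
      dsimp only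
      rw [sampleHom_map, op_comp, Functor.map_comp, comp_apply]
  obtain ⟨g, hg⟩ := compatible.exists_map
  rw [← hg, ← hg, h]

theorem exists_orderHom_range_eq {α : Type*} [LinearOrder α] {B : Finset α} (hB : B.Nonempty) :
    ∃ (k : ℕ) (A : Fin (k + 1) →o α), Set.range A = B := by
  obtain ⟨k, hk⟩ := Nat.exists_eq_succ_of_ne_zero hB.card_ne_zero
  exact ⟨k, (B.orderEmbOfFin hk).toOrderHom, B.range_orderEmbOfFin hk⟩

theorem exists_epi_sampleHom {n : ℕ} {v : stdSimplex ℝ (Fin (n + 1))} (hv : ∀ i, 0 < v i) :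
    ∃ B : Finset (Set.Ico (0 : ℝ) 1), ∀ {k : ℕ} (A : Fin (k + 1) →o Set.Ico (0 : ℝ) 1),
      (B : Set _) ⊆ Set.range A → Epi (sampleHom v A) := by
  classical
  choose c hc using surjective_quantile hv
  refine ⟨Finset.univ.image c, fun A hA => SimplexCategory.epi_iff_surjective.2 fun j => ?_⟩
  obtain ⟨i, hi⟩ := hA (Finset.mem_coe.2 (Finset.mem_image_of_mem c (Finset.mem_univ j)))
  exact ⟨i, (sampleHom_apply v A i).trans (by rw [hi, hc])⟩

theorem normalForm_unique {m n : ℕ} {σ : X _⦋m⦌} {τ : X _⦋n⦌}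
    (hσ : σ ∈ X.nonDegenerate m) (hτ : τ ∈ X.nonDegenerate n)
    {v : stdSimplex ℝ (Fin (m + 1))} {w : stdSimplex ℝ (Fin (n + 1))}
    (hv : ∀ i, 0 < v i) (hw : ∀ i, 0 < w i)
    (h : simplexMap X σ v = simplexMap X τ w) :
    (⟨m, σ, v⟩ : Σ n : ℕ, X _⦋n⦌ × stdSimplex ℝ (Fin (n + 1))) = ⟨n, τ, w⟩ := by
  classical
  obtain ⟨B, hB⟩ := exists_epi_sampleHom hv
  obtain ⟨B', hB'⟩ := exists_epi_sampleHom hw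
  have exists_chain (r : Set.Ico (0 : ℝ) 1) : ∃ (k : ℕ) (A : Fin (k + 1) →o Set.Ico (0 : ℝ) 1),
      r ∈ Set.range A ∧ Epi (sampleHom v A) ∧ Epi (sampleHom w A) := by
    obtain ⟨k, A, hA⟩ := exists_orderHom_range_eq (Finset.insert_nonempty r (B ∪ B'))
    exact ⟨k, A, by simp [hA], hB A fun s hs => by simp_all, hB' A fun s hs => by simp_all⟩
  obtain ⟨k, A, -, _, _⟩ := exists_chain ⟨0, by simp⟩
  obtain rfl : m = n := X.unique_nonDegenerate_dim _ (sampleHom v A) ⟨σ, hσ⟩ rfl (sampleHom w A)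
    ⟨τ, hτ⟩ (map_sampleHom_eq h A)
  have simplex_eq : σ = τ := congrArg Subtype.val <|
    X.unique_nonDegenerate_simplex _ (sampleHom v A) ⟨σ, hσ⟩ rfl
      (sampleHom w A) ⟨τ, hτ⟩ (map_sampleHom_eq h A)
  have point_eq : v = w := by
    refine injective_quantile (funext fun r => ?_)
    obtain ⟨k, A, ⟨i, rfl⟩, _, _⟩ := exists_chain r
    have sample_eq : sampleHom v A = sampleHom w A := X.unique_nonDegenerate_map _ (sampleHom v A)
      ⟨σ, hσ⟩ rfl (sampleHom w A) ⟨τ, hτ⟩ (map_sampleHom_eq h A)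
    rw [← sampleHom_apply, ← sampleHom_apply, sample_eq]
  rw [simplex_eq, point_eq]

end NormalForm

section Skeleton

variable {X : SSet.{u}} {n : ℕ}

variable (X n) in
/-- The `(n - 1)`-skeleton of `|X|`: the union of the images of the simplices of dimension less than
`n`. -/
def skeletonLT : Set |X| :=
  {y | ∃ m < n, ∃ (σ : X _⦋m⦌) (v : stdSimplex ℝ (Fin (m + 1))), simplexMap X σ v = y}

theorem simplexMap_mem_skeletonLT {m : ℕ} (h : m < n) (σ : X _⦋m⦌)
    (v : stdSimplex ℝ (Fin (m + 1))) : simplexMap X σ v ∈ skeletonLT X n := ⟨m, h, σ, v, rfl⟩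

theorem skeletonLT_mono : Monotone (skeletonLT X) := by
  rintro m n h _ ⟨l, hl, σ, v, rfl⟩
  exact simplexMap_mem_skeletonLT (hl.trans_le h) σ v

theorem exists_mem_skeletonLT (y : |X|) : ∃ n, y ∈ skeletonLT X n := by
  obtain ⟨n, σ, v, rfl⟩ := exists_simplexMap_eq y
  exact ⟨n + 1, simplexMap_mem_skeletonLT n.lt_succ_self σ v⟩

theorem exists_finite_subset_skeletonLT {S : Set |X|} (hS : S.Finite) :
    ∃ n, S ⊆ skeletonLT X n := by
  choose N hN using exists_mem_skeletonLT (X := X)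
  obtain ⟨M, hM⟩ := (hS.image N).bddAbove
  exact ⟨M, fun y hy => skeletonLT_mono (hM ⟨y, hy, rfl⟩) (hN y)⟩

theorem exists_stdSimplex_map_succAbove_eq {v : stdSimplex ℝ (Fin (n + 2))} {i : Fin (n + 2)}
    (hi : v i = 0) : ∃ w : stdSimplex ℝ (Fin (n + 1)), stdSimplex.map i.succAbove w = v := by
  have sum_eq_one : ∑ j, v (i.succAbove j) = 1 := by
    rw [← stdSimplex.sum_eq_one v, Fin.sum_univ_succAbove (fun j => v j) i, hi, zero_add]
  refine ⟨⟨fun j => v (i.succAbove j), fun j => v.2.1 _, sum_eq_one⟩, ?_⟩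
  refine stdSimplex.ext (funext fun j => ?_)
  rw [stdSimplex.map_coe, FunOnFinite.linearMap_apply_apply]
  obtain rfl | ⟨j, rfl⟩ := Fin.eq_self_or_eq_succAbove i j
  · rw [hi, Finset.sum_eq_zero]
    exact fun l hl => absurd (Finset.mem_filter.1 hl).2 (Fin.succAbove_ne _ _)
  · simp only [Fin.succAbove_right_inj, Finset.filter_eq', Finset.mem_univ, if_true,
      Finset.sum_singleton]
    rfl

theorem stdSimplex_pos_of_dim_zero (v : stdSimplex ℝ (Fin (0 + 1))) (i : Fin (0 + 1)) :
    0 < v i := by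
  have sum_eq_one := stdSimplex.sum_eq_one v
  rw [Fin.sum_univ_one] at sum_eq_one
  rw [Fin.fin_one_eq_zero i, sum_eq_one]
  exact one_pos

theorem simplexMap_mem_skeletonLT_of_coord_eq_zero (σ : X _⦋n⦌)
    {v : stdSimplex ℝ (Fin (n + 1))} {i : Fin (n + 1)} (hi : v i = 0) :
    simplexMap X σ v ∈ skeletonLT X n := by
  cases n with
  | zero => exact absurd hi (stdSimplex_pos_of_dim_zero v i).ne'
  | succ n =>
    obtain ⟨w, rfl⟩ := exists_stdSimplex_map_succAbove_eq hi
    rw [← simplexMap_δ]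
    exact simplexMap_mem_skeletonLT n.lt_succ_self _ _

theorem simplexMap_mem_skeletonLT_of_degenerate {σ : X _⦋n⦌} (hσ : σ ∈ X.degenerate n)
    (v : stdSimplex ℝ (Fin (n + 1))) : simplexMap X σ v ∈ skeletonLT X n := by
  obtain ⟨m, hm, f, τ, rfl⟩ := hσ
  rw [simplexMap_map]
  exact simplexMap_mem_skeletonLT hm _ _

theorem exists_normalForm_of_mem_skeletonLT {y : |X|} (hy : y ∈ skeletonLT X n) :
    ∃ m < n, ∃ σ ∈ X.nonDegenerate m, ∃ v : stdSimplex ℝ (Fin (m + 1)),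
      (∀ i, 0 < v i) ∧ simplexMap X σ v = y := by
  induction n with
  | zero =>
    obtain ⟨m, hm, -⟩ := hy
    omega
  | succ n ih =>
    by_cases hn : y ∈ skeletonLT X n
    · obtain ⟨m, hm, normalForm⟩ := ih hn
      exact ⟨m, by omega, normalForm⟩
    · obtain ⟨m, hm, σ, v, rfl⟩ := hy
      obtain rfl : m = n := by
        by_contra hne
        exact hn (simplexMap_mem_skeletonLT (by omega) σ v)
      refine ⟨m, hm, σ, fun hσ => hn (simplexMap_mem_skeletonLT_of_degenerate hσ v), v,
        fun i => (v.2.1 i).lt_of_ne' fun hi => ?_, rfl⟩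
      exact hn (simplexMap_mem_skeletonLT_of_coord_eq_zero σ hi)

theorem simplexMap_notMem_skeletonLT {σ : X _⦋n⦌} (hσ : σ ∈ X.nonDegenerate n)
    {v : stdSimplex ℝ (Fin (n + 1))} (hv : ∀ i, 0 < v i) : simplexMap X σ v ∉ skeletonLT X n := by
  intro h
  obtain ⟨m, hm, τ, hτ, w, hw, e⟩ := exists_normalForm_of_mem_skeletonLT h
  exact hm.ne (congrArg Sigma.fst (normalForm_unique hτ hσ hw hv e))

end Skeleton

section Closed

variable {X : SSet.{u}} {n : ℕ}

theorem preimage_simplexMap_eq_union_faces {A : Set |X|} {σ : X _⦋n + 1⦌}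
    {B : Set (stdSimplex ℝ (Fin (n + 2)))} (hBA : B ⊆ simplexMap X σ ⁻¹' A)
    (hAB : ∀ v, (∀ i, 0 < v i) → simplexMap X σ v ∈ A → v ∈ B) :
    simplexMap X σ ⁻¹' A =
      B ∪ ⋃ i : Fin (n + 2), stdSimplex.map i.succAbove '' (simplexMap X (X.δ i σ) ⁻¹' A) := by
  ext v
  simp only [Set.mem_preimage, Set.mem_union, Set.mem_iUnion, Set.mem_image]
  constructor
  · intro hv
    by_cases hpos : ∀ i, 0 < v i
    · exact Or.inl (hAB v hpos hv)
    · push Not at hpos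
      obtain ⟨i, hi⟩ := hpos
      obtain ⟨w, rfl⟩ := exists_stdSimplex_map_succAbove_eq (le_antisymm hi (v.2.1 i))
      exact Or.inr ⟨i, w, by rwa [simplexMap_δ], rfl⟩
  · rintro (hv | ⟨i, w, hw, rfl⟩)
    · exact hBA hv
    · rwa [simplexMap_δ] at hw

theorem isClosed_of_nonDegenerate {A : Set |X|}
    (hA : ∀ (n : ℕ) (σ : X _⦋n⦌), σ ∈ X.nonDegenerate n →
      ∃ B : Set (stdSimplex ℝ (Fin (n + 1))), IsClosed B ∧ B ⊆ simplexMap X σ ⁻¹' A ∧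
        ∀ v, (∀ i, 0 < v i) → simplexMap X σ v ∈ A → v ∈ B) : IsClosed A := by
  refine isClosed_iff_preimage_simplexMap.2 fun n => ?_
  induction n using Nat.strong_induction_on with
  | _ n ih =>
  intro σ
  by_cases hσ : σ ∈ X.nonDegenerate n
  · obtain ⟨B, hB, hBA, hAB⟩ := hA n σ hσ
    cases n with
    | zero =>
      convert hB using 1
      exact Set.Subset.antisymm (fun v hv => hAB v (stdSimplex_pos_of_dim_zero v) hv) hBA
    | succ n =>
      rw [preimage_simplexMap_eq_union_faces hBA hAB]
      refine hB.union (isClosed_iUnion_of_finite fun i => ?_)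
      exact ((ih n n.lt_succ_self (X.δ i σ)).isCompact.image (stdSimplex.continuous_map _)).isClosed
  · rw [← SSet.mem_degenerate_iff_notMem_nonDegenerate] at hσ
    obtain ⟨m, hm, f, τ, rfl⟩ := hσ
    have preimage_eq : simplexMap X (X.map f.op τ) ⁻¹' A =
        stdSimplex.map f ⁻¹' (simplexMap X τ ⁻¹' A) := by
      ext v
      simp only [Set.mem_preimage, simplexMap_map]
    rw [preimage_eq]
    exact (ih m hm τ).preimage (stdSimplex.continuous_map _)

theorem isClosed_of_subset_skeletonLT {A : Set |X|} (hn : A ⊆ skeletonLT X n)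
    (hA : ∀ m < n, ∀ σ ∈ X.nonDegenerate m, IsClosed (simplexMap X σ ⁻¹' A)) :
    IsClosed A := by
  refine isClosed_of_nonDegenerate fun m σ hσ => ?_
  by_cases h : m < n
  · exact ⟨_, hA m h σ hσ, subset_rfl, fun _ _ hv => hv⟩
  · refine ⟨∅, isClosed_empty, Set.empty_subset _, fun v hv hvA => ?_⟩
    exact absurd (skeletonLT_mono (not_lt.1 h) (hn hvA)) (simplexMap_notMem_skeletonLT hσ hv)

theorem isClosed_of_finite_inter_skeletonLT {A : Set |X|}
    (hA : ∀ n, (A ∩ skeletonLT X n).Finite) : IsClosed A := by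
  refine isClosed_of_nonDegenerate fun n σ hσ =>
    ⟨{v | (∀ i, 0 < v i) ∧ simplexMap X σ v ∈ A}, Set.Finite.isClosed ?_,
      fun v hv => hv.2, fun v hv hvA => ⟨hv, hvA⟩⟩
  refine .of_finite_image (f := simplexMap X σ) ((hA (n + 1)).subset ?_) ?_
  · rintro _ ⟨v, hv, rfl⟩
    exact ⟨hv.2, simplexMap_mem_skeletonLT n.lt_succ_self σ v⟩
  · intro v hv w hw e
    simpa using normalForm_unique hσ hσ hv.1 hw.1 e

theorem finite_of_isCompact_of_finite_inter_skeletonLT {K : Set |X|} (hK : IsCompact K)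
    (hfin : ∀ n, (K ∩ skeletonLT X n).Finite) : K.Finite := by
  refine hK.finite (isDiscrete_iff_discreteTopology.2 ?_)
  rw [discreteTopology_iff_forall_isClosed]
  intro S
  rw [← Set.preimage_image_eq S Subtype.val_injective]
  refine (isClosed_of_finite_inter_skeletonLT fun n => ?_).preimage continuous_subtype_val
  exact (hfin n).subset (Set.inter_subset_inter_left _ (Subtype.coe_image_subset K S))

theorem exists_subset_skeletonLT_of_isCompact {K : Set |X|} (hK : IsCompact K) :
    ∃ n, K ⊆ skeletonLT X n := by
  by_contra! not_subset
  choose y hyK hy using fun n => Set.not_subset.1 (not_subset n)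
  have finite_inter (n : ℕ) : (Set.range y ∩ skeletonLT X n).Finite := by
    refine ((Set.finite_lt_nat n).image y).subset ?_
    rintro _ ⟨⟨m, rfl⟩, hm⟩
    exact ⟨m, lt_of_not_ge fun h => hy m (skeletonLT_mono h hm), rfl⟩
  have isCompact_range : IsCompact (Set.range y) :=
    hK.of_isClosed_subset (isClosed_of_finite_inter_skeletonLT finite_inter)
      (Set.range_subset_iff.2 hyK)
  obtain ⟨N, hN⟩ := exists_finite_subset_skeletonLT
    (finite_of_isCompact_of_finite_inter_skeletonLT isCompact_range finite_inter)
  exact hy N (hN ⟨N, rfl⟩)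

end Closed

/-- The space of functions `[0, 1) → H`, where the distance of two functions is the outer measure of
the set on which they differ. No measurability is needed, since the outer measure is subadditive. -/
def StepSpace (H : Type*) : Type _ := Set.Ico (0 : ℝ) 1 → H

namespace StepSpace

section Metric

variable {H : Type*}

/-- The set on which two functions differ. -/
def diffSet (f g : StepSpace H) : Set ℝ := Subtype.val '' {r | f r ≠ g r}

theorem diffSet_subset (f g : StepSpace H) : diffSet f g ⊆ Set.Ico 0 1 := by
  rintro _ ⟨r, -, rfl⟩
  exact r.2

theorem volume_ne_top_of_subset_Ico {s : Set ℝ} (hs : s ⊆ Set.Ico 0 1) :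
    MeasureTheory.volume s ≠ ⊤ :=
  ne_top_of_le_ne_top (by simp) (MeasureTheory.measure_mono hs)

theorem diffSet_subset_union (f g h : StepSpace H) : diffSet f h ⊆ diffSet f g ∪ diffSet g h := by
  rintro _ ⟨r, hr, rfl⟩
  by_cases hfg : f r = g r
  · exact Or.inr ⟨r, fun hgh => hr (hfg.trans hgh), rfl⟩
  · exact Or.inl ⟨r, hfg, rfl⟩

instance : PseudoMetricSpace (StepSpace H) where
  dist f g := MeasureTheory.volume.real (diffSet f g)
  dist_self f := by simp [diffSet]
  dist_comm f g := by simp only [diffSet, ne_comm]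
  dist_triangle f g h := (MeasureTheory.measureReal_mono (diffSet_subset_union f g h)
    (volume_ne_top_of_subset_Ico
      (Set.union_subset (diffSet_subset f g) (diffSet_subset g h)))).trans
    (MeasureTheory.measureReal_union_le _ _)

theorem dist_def (f g : StepSpace H) : dist f g = MeasureTheory.volume.real (diffSet f g) := rfl

end Metric

section Quantile

variable {H ι : Type*} [Fintype ι] [LinearOrder ι]

/-- The step function with the values `f i` on consecutive intervals of lengths `v i`. -/
def step (f : ι → H) (v : stdSimplex ℝ ι) : StepSpace H := fun r => f (quantile v r)

theorem dist_step_le (f : ι → H) (v w : stdSimplex ℝ ι) :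
    dist (step f v) (step f w) ≤ ∑ j, |(∑ i with i ≤ j, v i) - ∑ i with i ≤ j, w i| := by
  have diffSet_subset : diffSet (step f v) (step f w) ⊆
      ⋃ j, Set.uIcc (∑ i with i ≤ j, v i) (∑ i with i ≤ j, w i) := by
    rintro _ ⟨r, hr, rfl⟩
    exact Set.mem_iUnion.2 (exists_mem_uIcc_of_quantile_ne fun h => hr (congrArg f h))
  rw [dist_def]
  refine (MeasureTheory.measureReal_mono diffSet_subset ?_).trans ?_
  · exact (isCompact_iUnion fun _ => isCompact_uIcc).measure_ne_top
  · refine (MeasureTheory.measureReal_iUnion_fintype_le _).trans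
      (Finset.sum_le_sum fun j _ => ?_)
    rw [MeasureTheory.measureReal_def, Real.volume_interval, ENNReal.toReal_ofReal (abs_nonneg _),
      abs_sub_comm]

theorem continuous_step (f : ι → H) : Continuous (step f) := by
  refine continuous_iff_continuousAt.2 fun v => tendsto_iff_dist_tendsto_zero.2 ?_
  refine squeeze_zero (fun _ => dist_nonneg) (fun w => dist_step_le f w v) ?_
  have continuous_bound : Continuous fun w : stdSimplex ℝ ι =>
      ∑ j, |(∑ i with i ≤ j, w i) - ∑ i with i ≤ j, v i| :=
    continuous_finsetSum _ fun j _ =>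
      ((continuous_finsetSum _ fun i _ => continuous_stdSimplex_apply i).sub
        continuous_const).abs
  simpa using continuous_bound.tendsto v

end Quantile

section Action

variable {H : Type*} [Group H]

instance : MulAction H (StepSpace H) where
  smul h f := fun r => h * f r
  one_smul f := funext fun r => one_mul (f r)
  mul_smul a b f := funext fun r => mul_assoc a b (f r)

theorem smul_apply (h : H) (f : StepSpace H) (r : Set.Ico (0 : ℝ) 1) : (h • f) r = h * f r := rfl

theorem dist_smul_smul (h : H) (f g : StepSpace H) : dist (h • f) (h • g) = dist f g := by
  simp only [dist_def, diffSet, smul_apply, ne_eq, mul_right_inj]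

theorem dist_smul_self {h : H} (hh : h ≠ 1) (f : StepSpace H) : dist (h • f) f = 1 := by
  have diffSet_eq : diffSet (h • f) f = Set.Ico 0 1 := by
    refine Set.Subset.antisymm (diffSet_subset _ _) fun r hr => ⟨⟨r, hr⟩, ?_, rfl⟩
    exact mul_eq_right.not.2 hh
  rw [dist_def, diffSet_eq]
  simp

instance : ContinuousConstSMul H (StepSpace H) where
  continuous_const_smul h :=
    (Isometry.of_dist_eq fun f g => dist_smul_smul h f g).continuous

variable (H) in
/-- The quotient of the space of functions `[0, 1) → H` by left multiplication with constants; it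
plays the role of a classifying space of `H`. -/
def Quot : Type _ := Quotient (MulAction.orbitRel H (StepSpace H))

instance : TopologicalSpace (Quot H) :=
  inferInstanceAs (TopologicalSpace (Quotient (MulAction.orbitRel H (StepSpace H))))

/-- The projection to the quotient. -/
def proj (f : StepSpace H) : Quot H := Quotient.mk (MulAction.orbitRel H (StepSpace H)) f

theorem isQuotientCoveringMap_proj : IsQuotientCoveringMap (proj (H := H)) H where
  __ := (isQuotientMap_quotient_mk' :
    Topology.IsQuotientMap (Quotient.mk (MulAction.orbitRel H (StepSpace H))))
  apply_eq_iff_mem_orbit := Quotient.eq''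
  disjoint f := by
    refine ⟨Metric.ball f (1 / 2), Metric.ball_mem_nhds f (by norm_num), fun h => ?_⟩
    rintro ⟨_, ⟨g, hg, rfl⟩, hg'⟩
    by_contra hh
    have dist_smul : dist (h • g) g = 1 := dist_smul_self hh g
    have triangle := dist_triangle_right (h • g) g f
    rw [Metric.mem_ball] at hg hg'
    dsimp only at hg'
    linarith

end Action

end StepSpace

theorem exists_hom_of_isQuotientCoveringMap {E Q Y : Type u} [TopologicalSpace E]
    [TopologicalSpace Q] [TopologicalSpace Y] {H : Type*} [Group H] [MulAction H E] {p : E → Q}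
    (hp : IsQuotientCoveringMap p H) (g : C(Y, Q)) (y : Y) (e : E) (he : p e = g y) :
    ∃ Φ : Pi1 Y y →* H, ∀ (γ : Path y y) (Γ : C(unitInterval, E)) (h : H),
      (∀ t, p (Γ t) = g (γ t)) → Γ 0 = e → Γ 1 = h • e → Φ (Pi1.mk γ) = h := by
  let Ψ := (hp.fundamentalGroupToMulOpposite (x := g y) ⟨e, he⟩).comp (FundamentalGroup.map g y)
  refine ⟨⟨⟨fun a => (Ψ a.unop).unop, by
    rw [MulOpposite.unop_one, map_one, MulOpposite.unop_one]⟩, fun a b => by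
    simp only [MulOpposite.unop_mul, map_mul]⟩, fun γ Γ h hΓ h0 h1 => ?_⟩
  change (hp.fundamentalGroupToMulOpposite (x := g y) ⟨e, he⟩ _).unop = h
  rw [← MulOpposite.op_inj, MulOpposite.op_unop, hp.fundamentalGroupToMulOpposite_apply_eq_Iff,
    MulOpposite.unop_op, ← h1]
  have lift_eq := (hp.isCoveringMap.eq_liftPath_iff' (γ := (γ.map g.continuous).toContinuousMap)
    (e := e) (γ_0 := by simp [he]) (Γ := Γ)).2 ⟨funext hΓ, h0⟩
  exact congrArg (fun c : C(unitInterval, E) => c 1) lift_eq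

theorem stdSimplexHomeomorphUnitInterval_symm_zero :
    stdSimplexHomeomorphUnitInterval.symm 0 = stdSimplex.vertex (S := ℝ) (0 : Fin 2) := by
  rw [Homeomorph.symm_apply_eq]
  rfl

theorem stdSimplexHomeomorphUnitInterval_symm_one :
    stdSimplexHomeomorphUnitInterval.symm 1 = stdSimplex.vertex (S := ℝ) (1 : Fin 2) := by
  rw [Homeomorph.symm_apply_eq]
  rfl

section Edge

variable {X : SSet.{u}}

/-- The edge of a simplex between two of its vertices. -/
def edge (X : SSet.{u}) {n : ℕ} (σ : X _⦋n⦌) {i j : Fin (n + 1)} (h : i ≤ j) : X _⦋1⦌ :=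
  X.map (SimplexCategory.mkOfLe i j h).op σ

theorem edge_map {m n : ℕ} (f : ⦋m⦌ ⟶ ⦋n⦌) (σ : X _⦋n⦌) {i j : Fin (m + 1)}
    (h : i ≤ j) : edge X (X.map f.op σ) h = edge X σ (f.toOrderHom.monotone h) := by
  unfold edge
  rw [← comp_apply, ← Functor.map_comp, ← op_comp]
  congr 4
  exact SimplexCategory.Hom.ext_one_left _ _

theorem exists_triangle {n : ℕ} (σ : X _⦋n⦌) {i j k : Fin (n + 1)} (hij : i ≤ j)
    (hjk : j ≤ k) : ∃ t : X _⦋2⦌, X.δ 2 t = edge X σ hij ∧ X.δ 0 t = edge X σ hjk ∧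
      X.δ 1 t = edge X σ (hij.trans hjk) := by
  refine ⟨X.map (SimplexCategory.mkOfLeComp i j k hij hjk).op σ, ?_, ?_, ?_⟩
  all_goals
    unfold edge SimplicialObject.δ
    rw [← comp_apply, ← Functor.map_comp, ← op_comp]
    congr 4
    exact SimplexCategory.Hom.ext_one_left _ _

theorem edge_zero_one (a : X _⦋1⦌) : edge X a (Fin.zero_le 1) = a := by
  have mkOfLe_eq_id : SimplexCategory.mkOfLe (0 : Fin (1 + 1)) 1 (Fin.zero_le 1) = 𝟙 _ :=
    SimplexCategory.Hom.ext_one_left _ _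
  unfold edge
  rw [mkOfLe_eq_id, op_id, CategoryTheory.Functor.map_id, id_apply]

end Edge

section Cocycle

variable {X : SSet.{u}} {H : Type u}

/-- The developing map of a cocycle on a simplex: vertices are labelled by the value of the cocycle
on the edge from the first vertex, and a point of the simplex becomes the corresponding step
function. -/
def develop (φ : X _⦋1⦌ → H) {n : ℕ} (σ : X _⦋n⦌) : stdSimplex ℝ (Fin (n + 1)) → StepSpace H :=
  StepSpace.step fun j => φ (edge X σ (Fin.zero_le j))

theorem develop_apply (φ : X _⦋1⦌ → H) {n : ℕ} (σ : X _⦋n⦌) (v : stdSimplex ℝ (Fin (n + 1)))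
    (r : Set.Ico (0 : ℝ) 1) : develop φ σ v r = φ (edge X σ (Fin.zero_le (quantile v r))) := rfl

theorem develop_vertex (φ : X _⦋1⦌ → H) {n : ℕ} (σ : X _⦋n⦌) (j : Fin (n + 1)) :
    develop φ σ (stdSimplex.vertex j) = fun _ => φ (edge X σ (Fin.zero_le j)) := by
  funext r
  simp only [develop_apply, quantile_vertex]

/-- A function on the edges is a cocycle if it is multiplicative on the triangles of `X`. -/
def IsCocycle {M : Type*} [Mul M] (φ : X _⦋1⦌ → M) : Prop :=
  ∀ t : X _⦋2⦌, φ (X.δ 1 t) = φ (X.δ 2 t) * φ (X.δ 0 t)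

theorem IsCocycle.edge_trans {M : Type*} [Mul M] {φ : X _⦋1⦌ → M} (hφ : IsCocycle φ) {n : ℕ}
    (σ : X _⦋n⦌) {i j k : Fin (n + 1)} (hij : i ≤ j) (hjk : j ≤ k) :
    φ (edge X σ (hij.trans hjk)) = φ (edge X σ hij) * φ (edge X σ hjk) := by
  obtain ⟨t, h2, h0, h1⟩ := exists_triangle σ hij hjk
  rw [← h2, ← h0, ← h1, hφ]

variable [Group H] {φ : X _⦋1⦌ → H}

theorem IsCocycle.edge_refl (hφ : IsCocycle φ) {n : ℕ} (σ : X _⦋n⦌) (i : Fin (n + 1)) :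
    φ (edge X σ (le_refl i)) = 1 :=
  left_eq_mul.1 (hφ.edge_trans σ (le_refl i) (le_refl i))

theorem IsCocycle.develop_map (hφ : IsCocycle φ) {m n : ℕ} (f : ⦋m⦌ ⟶ ⦋n⦌) (σ : X _⦋n⦌)
    (v : stdSimplex ℝ (Fin (m + 1))) :
    φ (edge X σ (Fin.zero_le (f.toOrderHom 0))) • develop φ (X.map f.op σ) v =
      develop φ σ (stdSimplex.map f v) := by
  funext r
  have quantile_eq : quantile (stdSimplex.map f v) r = f.toOrderHom (quantile v r) :=
    quantile_map f.toOrderHom v r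
  simp only [StepSpace.smul_apply, develop_apply, edge_map, ← hφ.edge_trans, quantile_eq]

theorem IsCocycle.exists_continuousMap (hφ : IsCocycle φ) :
    ∃ g : C(|X|, StepSpace.Quot H), ∀ (n : ℕ) (σ : X _⦋n⦌) (v : stdSimplex ℝ (Fin (n + 1))),
      g (simplexMap X σ v) = StepSpace.proj (develop φ σ v) := by
  have compatible : IsCompatible fun n (σ : X _⦋n⦌) v => StepSpace.proj (develop φ σ v) :=
    fun m n f σ v => StepSpace.isQuotientCoveringMap_proj.apply_eq_iff_mem_orbit.2
      ⟨(φ (edge X σ (Fin.zero_le (f.toOrderHom 0))))⁻¹,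
        inv_smul_eq_iff.2 (hφ.develop_map f σ v).symm⟩
  exact compatible.exists_continuousMap fun n σ =>
    StepSpace.isQuotientCoveringMap_proj.continuous.comp (StepSpace.continuous_step _)

theorem IsCocycle.exists_hom (hφ : IsCocycle φ) (x : X _⦋0⦌) (hx : ∀ y : X _⦋0⦌, y = x) :
    ∃ Φ : Pi1 |X| (vertexPoint X x) →* H, ∀ a : X _⦋1⦌, Φ (edgeClass X x hx a) = φ a := by
  obtain ⟨g, hg⟩ := hφ.exists_continuousMap
  let basepoint : StepSpace H := fun _ => 1
  have develop_zero {n : ℕ} (σ : X _⦋n⦌) :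
      develop φ σ (stdSimplex.vertex 0) = basepoint := by
    rw [develop_vertex]
    exact funext fun _ => hφ.edge_refl σ 0
  obtain ⟨Φ, hΦ⟩ := exists_hom_of_isQuotientCoveringMap StepSpace.isQuotientCoveringMap_proj g
    (vertexPoint X x) basepoint (by
      rw [vertexPoint, hg, ← develop_zero x]
      congr 2
      exact Subsingleton.elim _ _)
  let lift (a : X _⦋1⦌) : C(unitInterval, StepSpace H) :=
    ⟨fun t => develop φ a (stdSimplexHomeomorphUnitInterval.symm t),
      (StepSpace.continuous_step _).comp stdSimplexHomeomorphUnitInterval.symm.continuous⟩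
  have lift_zero (a : X _⦋1⦌) : lift a 0 = basepoint :=
    (congrArg (develop φ a) stdSimplexHomeomorphUnitInterval_symm_zero).trans (develop_zero a)
  have lift_one (a : X _⦋1⦌) : lift a 1 = φ a • basepoint := by
    refine (congrArg (develop φ a) stdSimplexHomeomorphUnitInterval_symm_one).trans ?_
    rw [develop_vertex]
    funext r
    rw [StepSpace.smul_apply, mul_one]
    exact congrArg φ (edge_zero_one a)
  exact ⟨Φ, fun a => hΦ _ (lift a) _ (fun t => (hg 1 a _).symm) (lift_zero a) (lift_one a)⟩

end Cocycle

section Collar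

variable {ι : Type*} [Fintype ι] [Nonempty ι]

/-- The smallest barycentric coordinate of a point of a simplex. -/
def minCoord (v : stdSimplex ℝ ι) : ℝ :=
  Finset.univ.inf' Finset.univ_nonempty fun i => v i

theorem minCoord_le (v : stdSimplex ℝ ι) (i : ι) : minCoord v ≤ v i :=
  Finset.inf'_le _ (Finset.mem_univ i)

theorem exists_eq_minCoord (v : stdSimplex ℝ ι) : ∃ i, v i = minCoord v := by
  obtain ⟨i, -, hi⟩ := Finset.exists_mem_eq_inf' (Finset.univ_nonempty (α := ι)) fun i => v i
  exact ⟨i, hi.symm⟩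

theorem minCoord_nonneg (v : stdSimplex ℝ ι) : 0 ≤ minCoord v := by
  obtain ⟨i, hi⟩ := exists_eq_minCoord v
  exact hi ▸ v.2.1 i

theorem continuous_minCoord : Continuous (minCoord : stdSimplex ℝ ι → ℝ) :=
  Continuous.finset_inf'_apply _ fun i _ => continuous_stdSimplex_apply i

variable (ι) in
/-- The width of the collar of the boundary of a simplex: half of the coordinate of the
barycenter. -/
def collarWidth : ℝ := 1 / (2 * Fintype.card ι)

theorem collarWidth_pos : 0 < collarWidth ι := by
  unfold collarWidth
  positivity

theorem card_mul_collarWidth : Fintype.card ι * collarWidth ι = 1 / 2 := by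
  unfold collarWidth
  field_simp

theorem coord_pos_of_collarWidth_le {v : stdSimplex ℝ ι} (hv : collarWidth ι ≤ minCoord v)
    (i : ι) : 0 < v i :=
  collarWidth_pos.trans_le (hv.trans (minCoord_le v i))

/-- The amount which the deformation `push` subtracts from each coordinate at time `s`. -/
def pushDepth (s : unitInterval) (v : stdSimplex ℝ ι) : ℝ :=
  s * min (minCoord v) (collarWidth ι)

theorem pushDepth_le_min (s : unitInterval) (v : stdSimplex ℝ ι) :
    pushDepth s v ≤ min (minCoord v) (collarWidth ι) :=
  mul_le_of_le_one_left (le_min (minCoord_nonneg v) collarWidth_pos.le) s.2.2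

theorem pushDepth_le_coord (s : unitInterval) (v : stdSimplex ℝ ι) (i : ι) :
    pushDepth s v ≤ v i :=
  ((pushDepth_le_min s v).trans (min_le_left _ _)).trans (minCoord_le v i)

theorem one_sub_card_mul_pushDepth_pos (s : unitInterval) (v : stdSimplex ℝ ι) :
    0 < 1 - Fintype.card ι * pushDepth s v := by
  have depth_le : Fintype.card ι * pushDepth s v ≤ Fintype.card ι * collarWidth ι :=
    mul_le_mul_of_nonneg_left ((pushDepth_le_min s v).trans (min_le_right _ _))
      (Nat.cast_nonneg _)
  rw [card_mul_collarWidth] at depth_le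
  linarith

/-- The deformation of the simplex which pushes a collar of the boundary into the boundary: it
subtracts a multiple of the smallest coordinate, at most the width of the collar, from all
coordinates and rescales. -/
def push (s : unitInterval) (v : stdSimplex ℝ ι) : stdSimplex ℝ ι :=
  ⟨fun i => (v i - pushDepth s v) / (1 - Fintype.card ι * pushDepth s v),
    fun i => div_nonneg (sub_nonneg.2 (pushDepth_le_coord s v i))
      (one_sub_card_mul_pushDepth_pos s v).le, by
      rw [← Finset.sum_div, Finset.sum_sub_distrib, stdSimplex.sum_eq_one, Finset.sum_const,
        Finset.card_univ, nsmul_eq_mul, div_self (one_sub_card_mul_pushDepth_pos s v).ne']⟩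

theorem push_apply (s : unitInterval) (v : stdSimplex ℝ ι) (i : ι) :
    push s v i = (v i - pushDepth s v) / (1 - Fintype.card ι * pushDepth s v) := rfl

theorem continuous_push : Continuous fun p : unitInterval × stdSimplex ℝ ι => push p.1 p.2 := by
  have continuous_depth : Continuous fun p : unitInterval × stdSimplex ℝ ι =>
      pushDepth p.1 p.2 := by
    have := continuous_minCoord (ι := ι)
    unfold pushDepth
    fun_prop
  refine Continuous.subtype_mk (continuous_pi fun i => Continuous.div ?_ ?_ ?_) _
  · exact ((continuous_stdSimplex_apply i).comp continuous_snd).sub continuous_depth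
  · fun_prop
  · exact fun p => (one_sub_card_mul_pushDepth_pos p.1 p.2).ne'

theorem push_eq_self {s : unitInterval} {v : stdSimplex ℝ ι} (h : pushDepth s v = 0) :
    push s v = v := by
  refine stdSimplex.ext (funext fun i => ?_)
  rw [push_apply, h, mul_zero, sub_zero, sub_zero, div_one]

theorem push_zero (v : stdSimplex ℝ ι) : push 0 v = v :=
  push_eq_self (zero_mul _)

theorem push_of_coord_eq_zero (s : unitInterval) {v : stdSimplex ℝ ι} {i : ι} (hi : v i = 0) :
    push s v = v := by
  have minCoord_eq : minCoord v = 0 := le_antisymm (hi ▸ minCoord_le v i) (minCoord_nonneg v)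
  refine push_eq_self ?_
  rw [pushDepth, minCoord_eq, min_eq_left collarWidth_pos.le, mul_zero]

theorem exists_push_one_apply_eq_zero {v : stdSimplex ℝ ι} (h : minCoord v ≤ collarWidth ι) :
    ∃ i, push 1 v i = 0 := by
  obtain ⟨i, hi⟩ := exists_eq_minCoord v
  refine ⟨i, ?_⟩
  rw [push_apply, pushDepth, min_eq_left h, hi, Set.Icc.coe_one, one_mul, sub_self, zero_div]

/-- The track of a point under the deformation `push`. -/
def pushTrack (v : stdSimplex ℝ ι) : C(unitInterval, stdSimplex ℝ ι) :=
  ⟨fun s => push s v, continuous_push.comp (Continuous.prodMk_left v)⟩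

theorem continuous_pushTrack : Continuous (pushTrack : stdSimplex ℝ ι → _) :=
  ContinuousMap.continuous_of_continuous_uncurry _ <|
    continuous_push.comp (continuous_snd.prodMk continuous_fst)

end Collar

section Cells

variable {X : SSet.{u}}

theorem mem_skeletonLT_succ_iff {n : ℕ} {y : |X|} :
    y ∈ skeletonLT X (n + 1) ↔ y ∈ skeletonLT X n ∨
      ∃ σ ∈ X.nonDegenerate n, ∃ v : stdSimplex ℝ (Fin (n + 1)),
        (∀ i, 0 < v i) ∧ simplexMap X σ v = y := by
  constructor
  · intro hy
    obtain ⟨m, hm, σ, hσ, v, hv, rfl⟩ := exists_normalForm_of_mem_skeletonLT hy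
    obtain hmn | rfl := Nat.lt_succ_iff_lt_or_eq.1 hm
    · exact Or.inl (simplexMap_mem_skeletonLT hmn σ v)
    · exact Or.inr ⟨σ, hσ, v, hv, rfl⟩
  · rintro (hy | ⟨σ, -, v, -, rfl⟩)
    · exact skeletonLT_mono n.le_succ hy
    · exact simplexMap_mem_skeletonLT n.lt_succ_self σ v

theorem eq_and_eq_of_simplexMap_eq {n : ℕ} {σ τ : X _⦋n⦌} (hσ : σ ∈ X.nonDegenerate n)
    (hτ : τ ∈ X.nonDegenerate n) {v w : stdSimplex ℝ (Fin (n + 1))} (hw : ∀ i, 0 < w i)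
    (h : simplexMap X σ v = simplexMap X τ w) : σ = τ ∧ v = w := by
  have hv (i) : 0 < v i := by
    refine (v.2.1 i).lt_of_ne' fun hi => simplexMap_notMem_skeletonLT hτ hw ?_
    exact h ▸ simplexMap_mem_skeletonLT_of_coord_eq_zero σ hi
  simpa only [Sigma.mk.injEq, true_and, heq_eq_eq, Prod.mk.injEq] using
    normalForm_unique hσ hτ hv hw h

theorem isClosed_skeletonLT (n : ℕ) : IsClosed (skeletonLT X n) :=
  isClosed_of_subset_skeletonLT subset_rfl fun m hm σ _ => by
    have preimage_eq : simplexMap X σ ⁻¹' skeletonLT X n = Set.univ :=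
      Set.eq_univ_of_forall fun v => simplexMap_mem_skeletonLT hm σ v
    exact preimage_eq ▸ isClosed_univ

open Classical in
variable (X) in
/-- The track of a point of `|X|` under the deformation `push` of the nondegenerate `n`-simplices;
it is constant outside of their interiors. -/
def cellPush (n : ℕ) (y : |X|) : C(unitInterval, |X|) :=
  if h : ∃ p : X _⦋n⦌ × stdSimplex ℝ (Fin (n + 1)), p.1 ∈ X.nonDegenerate n ∧ (∀ i, 0 < p.2 i) ∧
      simplexMap X p.1 p.2 = y
  then (simplexMap X h.choose.1).comp (pushTrack h.choose.2)
  else ContinuousMap.const _ y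

theorem cellPush_of_mem_skeletonLT {n : ℕ} {y : |X|} (hy : y ∈ skeletonLT X n) :
    cellPush X n y = ContinuousMap.const _ y := by
  refine dif_neg ?_
  rintro ⟨p, hp, hpos, rfl⟩
  exact simplexMap_notMem_skeletonLT hp hpos hy

theorem cellPush_simplexMap {n : ℕ} {σ : X _⦋n⦌} (hσ : σ ∈ X.nonDegenerate n)
    (v : stdSimplex ℝ (Fin (n + 1))) :
    cellPush X n (simplexMap X σ v) = (simplexMap X σ).comp (pushTrack v) := by
  by_cases hv : ∀ i, 0 < v i
  · have h : ∃ p : X _⦋n⦌ × stdSimplex ℝ (Fin (n + 1)), p.1 ∈ X.nonDegenerate n ∧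
        (∀ i, 0 < p.2 i) ∧ simplexMap X p.1 p.2 = simplexMap X σ v := ⟨(σ, v), hσ, hv, rfl⟩
    obtain ⟨hτ, -, eq⟩ := h.choose_spec
    obtain ⟨hσ', hv'⟩ := eq_and_eq_of_simplexMap_eq hτ hσ hv eq
    rw [cellPush, dif_pos h, hσ', hv']
  · push Not at hv
    obtain ⟨i, hi⟩ := hv
    have coord_eq_zero : v i = 0 := le_antisymm hi (v.2.1 i)
    rw [cellPush_of_mem_skeletonLT (simplexMap_mem_skeletonLT_of_coord_eq_zero σ coord_eq_zero)]
    ext s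
    exact congrArg (simplexMap X σ) (push_of_coord_eq_zero s coord_eq_zero).symm

theorem continuousOn_cellPush (n : ℕ) : ContinuousOn (cellPush X n) (skeletonLT X (n + 1)) := by
  rw [continuousOn_iff_isClosed]
  intro t ht
  refine ⟨cellPush X n ⁻¹' t ∩ skeletonLT X (n + 1), ?_, by rw [Set.inter_assoc, Set.inter_self]⟩
  refine isClosed_of_subset_skeletonLT Set.inter_subset_right fun m hm σ hσ => ?_
  have continuous_comp : Continuous fun v => cellPush X n (simplexMap X σ v) := by
    obtain hmn | rfl := Nat.lt_succ_iff_lt_or_eq.1 hm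
    · simp only [cellPush_of_mem_skeletonLT (simplexMap_mem_skeletonLT hmn σ _)]
      exact ContinuousMap.continuous_const'.comp (simplexMap X σ).continuous
    · simp only [cellPush_simplexMap hσ]
      exact (ContinuousMap.continuous_postcomp _).comp continuous_pushTrack
  have preimage_eq : simplexMap X σ ⁻¹' (cellPush X n ⁻¹' t ∩ skeletonLT X (n + 1)) =
      (fun v => cellPush X n (simplexMap X σ v)) ⁻¹' t :=
    Set.ext fun v => and_iff_left (simplexMap_mem_skeletonLT hm σ v)
  exact preimage_eq ▸ ht.preimage continuous_comp

theorem cellPush_apply_zero {n : ℕ} {y : |X|} (hy : y ∈ skeletonLT X (n + 1)) :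
    cellPush X n y 0 = y := by
  obtain h | ⟨σ, hσ, v, -, rfl⟩ := mem_skeletonLT_succ_iff.1 hy
  · rw [cellPush_of_mem_skeletonLT h, ContinuousMap.const_apply]
  · rw [cellPush_simplexMap hσ]
    exact congrArg (simplexMap X σ) (push_zero v)

theorem exists_cellPush_eq_comp {n : ℕ} {y : |X|} (hy : y ∈ skeletonLT X (n + 1)) :
    ∃ (m : ℕ) (σ : X _⦋m⦌) (c : C(unitInterval, stdSimplex ℝ (Fin (m + 1)))),
      cellPush X n y = (simplexMap X σ).comp c := by
  obtain h | ⟨σ, hσ, v, -, rfl⟩ := mem_skeletonLT_succ_iff.1 hy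
  · obtain ⟨m, -, σ, v, rfl⟩ := id h
    exact ⟨m, σ, ContinuousMap.const _ v, cellPush_of_mem_skeletonLT h⟩
  · exact ⟨n, σ, pushTrack v, cellPush_simplexMap hσ v⟩

variable (X) in
/-- The points of the nondegenerate `n`-simplices outside of the collars of their boundaries. -/
def cellCore (n : ℕ) : Set |X| :=
  {y | ∃ σ ∈ X.nonDegenerate n, ∃ v : stdSimplex ℝ (Fin (n + 1)),
    collarWidth (Fin (n + 1)) ≤ minCoord v ∧ simplexMap X σ v = y}

theorem notMem_skeletonLT_of_mem_cellCore {n : ℕ} {y : |X|} (hy : y ∈ cellCore X n) :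
    y ∉ skeletonLT X n := by
  obtain ⟨σ, hσ, v, hv, rfl⟩ := hy
  exact simplexMap_notMem_skeletonLT hσ (coord_pos_of_collarWidth_le hv)

theorem isClosed_cellCore (n : ℕ) : IsClosed (cellCore X n) := by
  refine isClosed_of_nonDegenerate fun m σ hσ => ?_
  obtain rfl | hmn := eq_or_ne m n
  · refine ⟨{v | collarWidth (Fin (m + 1)) ≤ minCoord v},
      isClosed_le continuous_const continuous_minCoord, fun v hv => ⟨σ, hσ, v, hv, rfl⟩, ?_⟩
    rintro v hv ⟨τ, hτ, w, hw, eq⟩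
    obtain ⟨-, rfl⟩ := eq_and_eq_of_simplexMap_eq hτ hσ hv eq
    exact hw
  · refine ⟨∅, isClosed_empty, Set.empty_subset _, ?_⟩
    rintro v hv ⟨τ, hτ, w, hw, eq⟩
    exact absurd (congrArg Sigma.fst
      (normalForm_unique hσ hτ hv (coord_pos_of_collarWidth_le hw) eq.symm)) hmn

theorem cellPush_apply_one_mem_skeletonLT {n : ℕ} {y : |X|} (hy : y ∈ skeletonLT X (n + 1))
    (hcore : y ∉ cellCore X n) : cellPush X n y 1 ∈ skeletonLT X n := by
  obtain h | ⟨σ, hσ, v, -, rfl⟩ := mem_skeletonLT_succ_iff.1 hy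
  · rwa [cellPush_of_mem_skeletonLT h]
  · have mem_collar : minCoord v ≤ collarWidth (Fin (n + 1)) :=
      (not_le.1 fun hv => hcore ⟨σ, hσ, v, hv, rfl⟩).le
    obtain ⟨i, hi⟩ := exists_push_one_apply_eq_zero mem_collar
    rw [cellPush_simplexMap hσ]
    exact simplexMap_mem_skeletonLT_of_coord_eq_zero σ hi

variable (X) in
/-- The union of the lower skeleton with given subsets of the nondegenerate `n`-simplices. -/
def cellUnion (n : ℕ) (W : X _⦋n⦌ → Set (stdSimplex ℝ (Fin (n + 1)))) : Set |X| :=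
  {y | y ∈ skeletonLT X n ∨ ∃ σ ∈ X.nonDegenerate n, ∃ v ∈ W σ, simplexMap X σ v = y}

theorem simplexMap_mem_cellUnion_iff {n : ℕ} {W : X _⦋n⦌ → Set (stdSimplex ℝ (Fin (n + 1)))}
    {σ : X _⦋n⦌} (hσ : σ ∈ X.nonDegenerate n) {v : stdSimplex ℝ (Fin (n + 1))}
    (hv : ∀ i, 0 < v i) : simplexMap X σ v ∈ cellUnion X n W ↔ v ∈ W σ := by
  constructor
  · rintro (h | ⟨τ, hτ, w, hw, eq⟩)
    · exact absurd h (simplexMap_notMem_skeletonLT hσ hv)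
    · obtain ⟨rfl, rfl⟩ := eq_and_eq_of_simplexMap_eq hτ hσ hv eq
      exact hw
  · exact fun h => Or.inr ⟨σ, hσ, v, h, rfl⟩

theorem isClosed_cellUnion {n : ℕ} {W : X _⦋n⦌ → Set (stdSimplex ℝ (Fin (n + 1)))}
    (hW : ∀ σ, IsClosed (W σ)) : IsClosed (cellUnion X n W) := by
  refine isClosed_of_nonDegenerate fun m σ hσ => ?_
  obtain hmn | rfl | hmn := lt_trichotomy m n
  · exact ⟨Set.univ, isClosed_univ, fun v _ => Or.inl (simplexMap_mem_skeletonLT hmn σ v),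
      fun _ _ _ => trivial⟩
  · exact ⟨W σ, hW σ, fun v hv => Or.inr ⟨σ, hσ, v, hv, rfl⟩,
      fun v hv => (simplexMap_mem_cellUnion_iff hσ hv).1⟩
  · refine ⟨∅, isClosed_empty, Set.empty_subset _, fun v hv hmem => ?_⟩
    refine absurd ?_ (simplexMap_notMem_skeletonLT hσ hv)
    obtain hmem | ⟨τ, -, w, -, eq⟩ := hmem
    · exact skeletonLT_mono hmn.le hmem
    · exact eq ▸ simplexMap_mem_skeletonLT hmn τ w

theorem exists_lift_of_forall_notMem_skeletonLT {n : ℕ} {T : Type*} [TopologicalSpace T]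
    [ConnectedSpace T] (γ : C(T, |X|)) (hmem : ∀ t, γ t ∈ skeletonLT X (n + 1))
    (hnot : ∀ t, γ t ∉ skeletonLT X n) :
    ∃ σ ∈ X.nonDegenerate n, ∃ c : C(T, stdSimplex ℝ (Fin (n + 1))),
      ∀ t, γ t = simplexMap X σ (c t) := by
  have exists_coords (t : T) := (mem_skeletonLT_succ_iff.1 (hmem t)).resolve_left (hnot t)
  choose σ hσ c hc eq using exists_coords
  have isClosed_setOf (W : X _⦋n⦌ → Set (stdSimplex ℝ (Fin (n + 1)))) (hW : ∀ τ, IsClosed (W τ)) :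
      IsClosed {t | c t ∈ W (σ t)} := by
    have preimage_eq : γ ⁻¹' cellUnion X n W = {t | c t ∈ W (σ t)} := by
      ext t
      rw [Set.mem_preimage, ← eq t]
      exact simplexMap_mem_cellUnion_iff (hσ t) (hc t)
    exact preimage_eq ▸ (isClosed_cellUnion hW).preimage γ.continuous
  have continuous_c : Continuous c :=
    continuous_iff_isClosed.2 fun F hF => isClosed_setOf (fun _ => F) fun _ => hF
  let _ : TopologicalSpace (X _⦋n⦌) := ⊥
  have _ : DiscreteTopology (X _⦋n⦌) := ⟨rfl⟩
  have continuous_σ : Continuous σ :=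
    continuous_iff_isClosed.2 fun Λ _ => isClosed_setOf (fun τ => {_v | τ ∈ Λ}) fun _ =>
      isClosed_const
  obtain ⟨t₀⟩ := (inferInstance : Nonempty T)
  have σ_eq (t : T) : σ t = σ t₀ := PreconnectedSpace.constant inferInstance continuous_σ
  exact ⟨σ t₀, hσ t₀, ⟨c, continuous_c⟩, fun t => by rw [← eq t, σ_eq t]; rfl⟩

end Cells

section PathInduction

variable {Y : Type*} [TopologicalSpace Y]

/-- A property of paths which only depends on homotopy classes and is closed under composition. -/
structure IsMultiplicative (P : ∀ ⦃y z : Y⦄, Path y z → Prop) : Prop where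
  of_homotopic ⦃y z : Y⦄ ⦃p q : Path y z⦄ : p.Homotopic q → P p → P q
  trans ⦃y z w : Y⦄ ⦃p : Path y z⦄ ⦃q : Path z w⦄ : P p → P q → P (p.trans q)

theorem path_property_congr {P : ∀ ⦃y z : Y⦄, Path y z → Prop} {y z y' z' : Y} {p : Path y z}
    {q : Path y' z'} (h : ∀ t, p t = q t) (hp : P p) : P q := by
  obtain rfl : y = y' := by rw [← p.source, ← q.source, h]
  obtain rfl : z = z' := by rw [← p.target, ← q.target, h]
  obtain rfl : p = q := Path.ext (funext h)
  exact hp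

theorem Icc_convexComb_mem {a b : unitInterval} (hab : a ≤ b) (s : unitInterval) :
    Set.Icc.convexComb a b s ∈ Set.Icc a b := by
  have range_eq := Path.range_subpathAux a b
  rw [Set.uIcc_of_le hab] at range_eq
  exact range_eq ▸ Set.mem_range_self s

theorem IsMultiplicative.of_open_cover {P : ∀ ⦃y z : Y⦄, Path y z → Prop}
    (hP : IsMultiplicative P) {ι : Type*} {U : ι → Set unitInterval} (hU : ∀ i, IsOpen (U i))
    (hcover : ∀ t, ∃ i, t ∈ U i) {y z : Y} (p : Path y z)
    (h : ∀ i a b, a ≤ b → Set.Icc a b ⊆ U i → P (p.subpath a b)) : P p := by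
  obtain ⟨t, ht₀, ht_mono, ⟨N, hN⟩, htU⟩ :=
    exists_monotone_Icc_subset_open_cover_unitInterval hU fun s _ => Set.mem_iUnion.2 (hcover s)
  have piece (k : ℕ) : P (p.subpath (t k) (t (k + 1))) := by
    obtain ⟨i, hi⟩ := htU k
    exact h i _ _ (ht_mono k.le_succ) hi
  have initial_segment (k : ℕ) : P (p.subpath (t 0) (t k)) := by
    induction k with
    | zero =>
      obtain ⟨i, hi⟩ := htU 0
      exact h i _ _ le_rfl ((Set.Icc_subset_Icc_right (ht_mono (Nat.zero_le 1))).trans hi)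
    | succ k ih =>
      exact hP.of_homotopic ⟨Path.Homotopy.subpathTransSubpath p _ _ _⟩ (hP.trans ih (piece k))
  refine path_property_congr (fun s => ?_) (initial_segment N)
  rw [ht₀, hN N le_rfl, Path.subpath_zero_one]
  rfl

instance : ContractibleSpace unitInterval :=
  (convex_Icc (0 : ℝ) 1).contractibleSpace ⟨0, by simp⟩

instance {ι : Type*} [Fintype ι] [Nonempty ι] : ContractibleSpace (stdSimplex ℝ ι) := by
  classical
  exact (convex_stdSimplex ℝ ι).contractibleSpace
    ⟨_, (stdSimplex.vertex (S := ℝ) (Classical.arbitrary ι)).2⟩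

theorem homotopic_of_square (F : C(unitInterval × unitInterval, Y)) {y z y' z' : Y}
    {left : Path y z} {right : Path y' z'} {bottom : Path y y'} {top : Path z z'}
    (hleft : ∀ t, F (0, t) = left t) (hright : ∀ t, F (1, t) = right t)
    (hbottom : ∀ s, F (s, 0) = bottom s) (htop : ∀ s, F (s, 1) = top s) :
    (bottom.trans (right.trans top.symm)).Homotopic left := by
  obtain rfl : F (0, 0) = y := by rw [hleft, left.source]
  obtain rfl : F (0, 1) = z := by rw [hleft, left.target]
  obtain rfl : F (1, 0) = y' := by rw [hright, right.source]
  obtain rfl : F (1, 1) = z' := by rw [hright, right.target]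
  let leftSide : Path ((0 : unitInterval), (0 : unitInterval)) (0, 1) :=
    ⟨⟨fun t => (0, t), by fun_prop⟩, rfl, rfl⟩
  let rightSide : Path ((1 : unitInterval), (0 : unitInterval)) (1, 1) :=
    ⟨⟨fun t => (1, t), by fun_prop⟩, rfl, rfl⟩
  let bottomSide : Path ((0 : unitInterval), (0 : unitInterval)) (1, 0) :=
    ⟨⟨fun s => (s, 0), by fun_prop⟩, rfl, rfl⟩
  let topSide : Path ((0 : unitInterval), (1 : unitInterval)) (1, 1) :=
    ⟨⟨fun s => (s, 1), by fun_prop⟩, rfl, rfl⟩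
  obtain rfl : leftSide.map F.continuous = left := Path.ext (funext hleft)
  obtain rfl : rightSide.map F.continuous = right := Path.ext (funext hright)
  obtain rfl : bottomSide.map F.continuous = bottom := Path.ext (funext hbottom)
  obtain rfl : topSide.map F.continuous = top := Path.ext (funext htop)
  have homotopic : (bottomSide.trans (rightSide.trans topSide.symm)).Homotopic leftSide :=
    SimplyConnectedSpace.paths_homotopic _ _
  simpa only [Path.map_trans, Path.map_symm] using homotopic.map F

end PathInduction

section PathInductionRealization

variable {X : SSet.{u}} {P : ∀ ⦃y z : |X|⦄, Path y z → Prop}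

/-- The homotopy `cellPush` along a path in the skeleton. -/
def pushPath {n : ℕ} {y z : |X|} (p : Path y z) (hp : ∀ t, p t ∈ skeletonLT X (n + 1)) :
    C(unitInterval × unitInterval, |X|) :=
  ⟨fun q => cellPush X n (p q.2) q.1,
    (((continuousOn_cellPush n).comp_continuous p.continuous hp).comp continuous_snd).eval
      continuous_fst⟩

variable (X P) in
/-- The paths which stay inside of a single simplex have the property `P`. -/
def HoldsOnSimplices : Prop :=
  ∀ ⦃n : ℕ⦄ (σ : X _⦋n⦌) (c : C(unitInterval, stdSimplex ℝ (Fin (n + 1)))) ⦃y z : |X|⦄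
    (p : Path y z), (∀ t, p t = simplexMap X σ (c t)) → P p

theorem holds_of_pushed (hP : IsMultiplicative P) (hsimplex : HoldsOnSimplices X P)
    {n : ℕ} (hskel : ∀ ⦃y z : |X|⦄ (p : Path y z), (∀ t, p t ∈ skeletonLT X n) → P p)
    {y z y' z' : |X|} {p : Path y z} (hp : ∀ t, p t ∈ skeletonLT X (n + 1)) {q : Path y' z'}
    (hq : ∀ t, q t = cellPush X n (p t) 1) : P q := by
  have not_core_or_not_skeleton (t : unitInterval) :
      ∃ b : Bool, t ∈ p ⁻¹' (bif b then cellCore X n else skeletonLT X n)ᶜ := by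
    by_cases ht : p t ∈ cellCore X n
    · exact ⟨false, notMem_skeletonLT_of_mem_cellCore ht⟩
    · exact ⟨true, ht⟩
  refine hP.of_open_cover (fun b => ?_) not_core_or_not_skeleton q ?_
  · cases b
    · exact (isClosed_skeletonLT n).isOpen_compl.preimage p.continuous
    · exact (isClosed_cellCore n).isOpen_compl.preimage p.continuous
  rintro (_ | _) a b hab hU
  · obtain ⟨σ, hσ, c, hc⟩ := exists_lift_of_forall_notMem_skeletonLT
      (p.subpath a b).toContinuousMap (fun s => hp _) fun s => hU (Icc_convexComb_mem hab s)
    refine hsimplex σ ⟨fun s => pushTrack (c s) 1,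
      (continuous_pushTrack.comp c.continuous).eval_const 1⟩ _ fun s => ?_
    refine (hq _).trans ?_
    have lift_eq : p (Set.Icc.convexComb a b s) = simplexMap X σ (c s) := hc s
    rw [lift_eq, cellPush_simplexMap hσ]
    rfl
  · refine hskel _ fun s => ?_
    have pushed_eq : q.subpath a b s = cellPush X n (p (Set.Icc.convexComb a b s)) 1 := hq _
    rw [pushed_eq]
    exact cellPush_apply_one_mem_skeletonLT (hp _) (hU (Icc_convexComb_mem hab s))

theorem path_induction (hP : IsMultiplicative P) (hsimplex : HoldsOnSimplices X P) {y z : |X|}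
    (p : Path y z) : P p := by
  suffices h : ∀ (n : ℕ) ⦃y z : |X|⦄ (p : Path y z), (∀ t, p t ∈ skeletonLT X n) → P p by
    obtain ⟨n, hn⟩ := exists_subset_skeletonLT_of_isCompact (isCompact_range p.continuous)
    exact h n p fun t => hn ⟨t, rfl⟩
  intro n
  induction n with
  | zero =>
    intro y z p hp
    obtain ⟨m, hm, -⟩ := hp 0
    exact absurd hm (Nat.not_lt_zero m)
  | succ n ih =>
    intro y z p hp
    let pushed : Path (cellPush X n y 1) (cellPush X n z 1) :=
      ⟨⟨fun t => cellPush X n (p t) 1, (pushPath p hp).continuous.comp (Continuous.prodMk_right 1)⟩,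
        by simp only [p.source], by simp only [p.target]⟩
    let track {w : |X|} (hw : w ∈ skeletonLT X (n + 1)) : Path w (cellPush X n w 1) :=
      ⟨cellPush X n w, cellPush_apply_zero hw, rfl⟩
    have holds_track {w : |X|} (hw : w ∈ skeletonLT X (n + 1)) :
        P (track hw) ∧ P (track hw).symm := by
      obtain ⟨m, σ, c, hc⟩ := exists_cellPush_eq_comp hw
      exact ⟨hsimplex σ c _ (DFunLike.congr_fun hc),
        hsimplex σ (c.comp ⟨unitInterval.symm, unitInterval.continuous_symm⟩) _
          fun s => DFunLike.congr_fun hc (unitInterval.symm s)⟩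
    have hy : y ∈ skeletonLT X (n + 1) := p.source ▸ hp 0
    have hz : z ∈ skeletonLT X (n + 1) := p.target ▸ hp 1
    have homotopic : ((track hy).trans (pushed.trans (track hz).symm)).Homotopic p :=
      homotopic_of_square (pushPath p hp) (fun t => cellPush_apply_zero (hp t)) (fun _ => rfl)
        (fun s => congrArg (cellPush X n · s) p.source)
        (fun s => congrArg (cellPush X n · s) p.target)
    exact hP.of_homotopic homotopic (hP.trans (holds_track hy).1
      (hP.trans (holds_of_pushed hP hsimplex ih hp fun _ => rfl) (holds_track hz).2))

end PathInductionRealization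

namespace Pi1

variable {Y : Type u} [TopologicalSpace Y] {b : Y}

theorem mk_surjective : Function.Surjective (Pi1.mk : Path b b → Pi1 Y b) := by
  intro s
  obtain ⟨p, hp⟩ := Path.Homotopic.Quotient.mk_surjective (FundamentalGroup.toPath s.unop)
  exact ⟨p, congrArg MulOpposite.op hp⟩

theorem mk_eq_of_homotopic {p q : Path b b} (h : p.Homotopic q) : Pi1.mk p = Pi1.mk q :=
  congrArg MulOpposite.op (Path.Homotopic.Quotient.eq.2 h)

end Pi1

/-- Homotopy classes of paths with a fixed starting point, that is, the points of the universal
covering. -/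
def PathsFrom (Y : Type u) [TopologicalSpace Y] (b : Y) : Type u :=
  Σ y : Y, Path.Homotopic.Quotient b y

namespace PathsFrom

variable {Y : Type u} [TopologicalSpace Y] {b : Y}

/-- The homotopy class of a path. -/
def mk {y : Y} (p : Path b y) : PathsFrom Y b := ⟨y, Path.Homotopic.Quotient.mk p⟩

theorem mk_congr {y z : Y} {p : Path b y} {q : Path b z} (h : ∀ t, p t = q t) : mk p = mk q := by
  obtain rfl : y = z := by rw [← p.target, ← q.target, h]
  obtain rfl : p = q := Path.ext (funext h)
  rfl

theorem mk_eq_mk_iff {y : Y} {p q : Path b y} : mk p = mk q ↔ p.Homotopic q := by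
  rw [← Path.Homotopic.Quotient.eq]
  exact ⟨fun h => eq_of_heq (Sigma.mk.inj h).2, fun h => congrArg (Sigma.mk y) h⟩

instance : MulAction (Pi1 Y b) (PathsFrom Y b) where
  smul s e := ⟨e.1, Path.Homotopic.Quotient.trans (FundamentalGroup.toPath s.unop) e.2⟩
  one_smul e := Sigma.ext rfl (heq_of_eq (Path.Homotopic.Quotient.refl_trans e.2))
  mul_smul _ _ _ := Sigma.ext rfl (heq_of_eq (Path.Homotopic.Quotient.trans_assoc _ _ _))

theorem mk_smul_mk (p : Path b b) {y : Y} (q : Path b y) : Pi1.mk p • mk q = mk (p.trans q) := rfl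

theorem mk_smul_mk_refl (p : Path b b) : Pi1.mk p • mk (Path.refl b) = mk p :=
  mk_eq_mk_iff.2 ⟨Path.Homotopy.transRefl p⟩

theorem smul_mk_refl_injective :
    Function.Injective fun s : Pi1 Y b => s • mk (Path.refl b) := by
  intro s t h
  obtain ⟨p, rfl⟩ := Pi1.mk_surjective s
  obtain ⟨q, rfl⟩ := Pi1.mk_surjective t
  simp only [mk_smul_mk_refl] at h
  exact Pi1.mk_eq_of_homotopic (mk_eq_mk_iff.1 h)

theorem smul_mk_trans {s : Pi1 Y b} {y z : Y} {e e' : Path b y} (h : s • mk e = mk e')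
    (p : Path y z) : s • mk (e.trans p) = mk (e'.trans p) := by
  obtain ⟨l, rfl⟩ := Pi1.mk_surjective s
  rw [mk_smul_mk, mk_eq_mk_iff] at h
  rw [mk_smul_mk, mk_eq_mk_iff]
  exact Path.Homotopic.trans (Path.Homotopic.symm ⟨Path.Homotopy.transAssoc l e p⟩)
    (h.hcomp (Path.Homotopic.refl p))

end PathsFrom

theorem path_trans_apply_congr {Y : Type*} [TopologicalSpace Y] {y z w y' z' w' : Y}
    {p : Path y z} {q : Path z w} {p' : Path y' z'} {q' : Path z' w'}
    (hp : ∀ t, p t = p' t) (hq : ∀ t, q t = q' t) (t : unitInterval) :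
    p.trans q t = p'.trans q' t := by
  simp only [Path.trans_apply, hp, hq]

section EdgeClass

variable {X : SSet.{u}} {x : X _⦋0⦌} (hx : ∀ y : X _⦋0⦌, y = x)

include hx in
theorem simplexMap_vertex {n : ℕ} (σ : X _⦋n⦌) (i : Fin (n + 1)) :
    simplexMap X σ (stdSimplex.vertex i) = vertexPoint X x := by
  rw [vertexPoint, ← hx (X.map (SimplexCategory.const ⦋0⦌ ⦋n⦌ i).op σ), simplexMap_map,
    Subsingleton.elim (default : stdSimplex ℝ (Fin (0 + 1))) (stdSimplex.vertex 0),
    stdSimplex.map_vertex]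
  rfl

theorem edgeClass_edge {n : ℕ} (σ : X _⦋n⦌) {i j : Fin (n + 1)} (hij : i ≤ j)
    (c : Path (stdSimplex.vertex (S := ℝ) i) (stdSimplex.vertex j)) :
    edgeClass X x hx (edge X σ hij) =
      Pi1.mk ((c.map (simplexMap X σ).continuous).cast (simplexMap_vertex hx σ i).symm
        (simplexMap_vertex hx σ j).symm) := by
  let f : ⦋1⦌ ⟶ ⦋n⦌ := SimplexCategory.mkOfLe i j hij
  let straight : Path (stdSimplex.vertex (S := ℝ) i) (stdSimplex.vertex j) :=
    { toFun := fun t => stdSimplex.map f (stdSimplexHomeomorphUnitInterval.symm t)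
      continuous_toFun := (stdSimplex.continuous_map f).comp
        stdSimplexHomeomorphUnitInterval.symm.continuous
      source' := (congrArg (stdSimplex.map f) stdSimplexHomeomorphUnitInterval_symm_zero).trans
        (stdSimplex.map_vertex f 0)
      target' := (congrArg (stdSimplex.map f) stdSimplexHomeomorphUnitInterval_symm_one).trans
        (stdSimplex.map_vertex f 1) }
  have homotopic : straight.Homotopic c := SimplyConnectedSpace.paths_homotopic _ _
  rw [← Pi1.mk_eq_of_homotopic ((homotopic.map (simplexMap X σ)).pathCast
    (simplexMap_vertex hx σ i).symm (simplexMap_vertex hx σ j).symm), edgeClass]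
  congr 1
  ext t
  exact simplexMap_map f σ _

theorem edgeClass_edge_trans {n : ℕ} (σ : X _⦋n⦌) {i j k : Fin (n + 1)} (hij : i ≤ j)
    (hjk : j ≤ k) : edgeClass X x hx (edge X σ (hij.trans hjk)) =
      edgeClass X x hx (edge X σ hij) * edgeClass X x hx (edge X σ hjk) := by
  let c := PathConnectedSpace.somePath (stdSimplex.vertex (S := ℝ) i) (stdSimplex.vertex j)
  let d := PathConnectedSpace.somePath (stdSimplex.vertex (S := ℝ) j) (stdSimplex.vertex k)
  rw [edgeClass_edge hx σ hij c, edgeClass_edge hx σ hjk d,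
    edgeClass_edge hx σ (hij.trans hjk) (c.trans d), Pi1.mk_mul_mk]
  congr 1
  ext t
  rw [Path.cast_coe, Path.map_trans]
  exact path_trans_apply_congr (fun _ => rfl) (fun _ => rfl) t

theorem isCocycle_edgeClass : IsCocycle (edgeClass X x hx) := by
  intro t
  have faces : X.δ 1 t = edge X t (Fin.zero_le 2) ∧ X.δ 2 t = edge X t (Fin.zero_le 1) ∧
      X.δ 0 t = edge X t (i := 1) (j := 2) (by decide) := by
    unfold edge SimplicialObject.δ
    refine ⟨?_, ?_, ?_⟩
    all_goals
      congr 4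
      exact SimplexCategory.Hom.ext_one_left _ _
  rw [faces.1, faces.2.1, faces.2.2]
  exact edgeClass_edge_trans hx t (Fin.zero_le 1) _

/-- The class of the paths inside of a simplex from its initial vertex to a given point. -/
def simplexPathClass {n : ℕ} (σ : X _⦋n⦌) (v : stdSimplex ℝ (Fin (n + 1))) :
    PathsFrom |X| (vertexPoint X x) :=
  PathsFrom.mk (((PathConnectedSpace.somePath (stdSimplex.vertex 0) v).map
    (simplexMap X σ).continuous).cast (simplexMap_vertex hx σ 0).symm rfl)

theorem simplexPathClass_eq {n : ℕ} (σ : X _⦋n⦌) {v : stdSimplex ℝ (Fin (n + 1))}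
    (c : Path (stdSimplex.vertex 0) v) : simplexPathClass hx σ v =
      PathsFrom.mk ((c.map (simplexMap X σ).continuous).cast
        (simplexMap_vertex hx σ 0).symm rfl) :=
  PathsFrom.mk_eq_mk_iff.2 (((SimplyConnectedSpace.paths_homotopic _ c).map
    (simplexMap X σ)).pathCast _ _)

theorem simplexPathClass_default :
    simplexPathClass hx x default = PathsFrom.mk (Path.refl (vertexPoint X x)) :=
  PathsFrom.mk_congr fun _ => congrArg (simplexMap X x) (Subsingleton.elim _ _)

theorem edgeClass_smul_simplexPathClass {m n : ℕ} (f : ⦋m⦌ ⟶ ⦋n⦌) (σ : X _⦋n⦌)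
    (v : stdSimplex ℝ (Fin (m + 1))) :
    edgeClass X x hx (edge X σ (Fin.zero_le (f.toOrderHom 0))) •
      simplexPathClass hx (X.map f.op σ) v = simplexPathClass hx σ (stdSimplex.map f v) := by
  let c := PathConnectedSpace.somePath (stdSimplex.vertex (S := ℝ) (0 : Fin (n + 1)))
    (stdSimplex.vertex (f.toOrderHom 0))
  let d := PathConnectedSpace.somePath (stdSimplex.vertex (S := ℝ) (0 : Fin (m + 1))) v
  have vertex_eq : stdSimplex.vertex (S := ℝ) (f.toOrderHom 0) =
      stdSimplex.map f (stdSimplex.vertex (0 : Fin (m + 1))) := (stdSimplex.map_vertex _ _).symm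
  rw [edgeClass_edge hx σ _ c, simplexPathClass_eq hx _ d, PathsFrom.mk_smul_mk,
    simplexPathClass_eq hx σ (c.trans ((d.map (stdSimplex.continuous_map f)).cast vertex_eq rfl))]
  refine PathsFrom.mk_congr fun t => ?_
  rw [Path.map_trans, Path.cast_coe]
  refine path_trans_apply_congr (fun t => ?_) (fun t => ?_) t
  · rfl
  · exact simplexMap_map f σ (d t)

/-- The subgroup of the fundamental group which is generated by the edges. -/
def edgeSubgroup : Subgroup (Pi1 |X| (vertexPoint X x)) :=
  Subgroup.closure (Set.range (edgeClass X x hx))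

theorem exists_smul_simplexPathClass_eq {m n : ℕ} {σ : X _⦋m⦌} {τ : X _⦋n⦌}
    {v : stdSimplex ℝ (Fin (m + 1))} {w : stdSimplex ℝ (Fin (n + 1))}
    (h : simplexMap X σ v = simplexMap X τ w) :
    ∃ s : edgeSubgroup hx, s • simplexPathClass hx τ w = simplexPathClass hx σ v := by
  let orbit (e : PathsFrom |X| (vertexPoint X x)) :
      MulAction.orbitRel.Quotient (edgeSubgroup hx) (PathsFrom |X| (vertexPoint X x)) :=
    Quotient.mk _ e
  have compatible : IsCompatible fun n (σ : X _⦋n⦌) v => orbit (simplexPathClass hx σ v) :=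
    fun m n f σ v => Eq.symm <| Quotient.eq''.2
      ⟨⟨_, Subgroup.subset_closure ⟨_, rfl⟩⟩, edgeClass_smul_simplexPathClass hx f σ v⟩
  obtain ⟨g, hg⟩ := compatible.exists_map
  have orbit_eq : orbit (simplexPathClass hx σ v) = orbit (simplexPathClass hx τ w) := by
    rw [← hg, ← hg, h]
  exact Quotient.eq''.1 orbit_eq

/-- The path classes from the base point which are the product of a loop in the edge subgroup and a
path inside of a simplex. -/
def IsEdgeReachable (e : PathsFrom |X| (vertexPoint X x)) : Prop :=
  ∃ (s : edgeSubgroup hx) (n : ℕ) (σ : X _⦋n⦌) (v : stdSimplex ℝ (Fin (n + 1))),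
    s • simplexPathClass hx σ v = e

theorem IsEdgeReachable.trans_simplex {y z : |X|} {e : Path (vertexPoint X x) y}
    (he : IsEdgeReachable hx (PathsFrom.mk e)) {n : ℕ} (σ : X _⦋n⦌)
    (c : C(unitInterval, stdSimplex ℝ (Fin (n + 1)))) (p : Path y z)
    (hp : ∀ t, p t = simplexMap X σ (c t)) : IsEdgeReachable hx (PathsFrom.mk (e.trans p)) := by
  obtain ⟨s, m, τ, w, hs⟩ := he
  obtain rfl : y = simplexMap X σ (c 0) := p.source.symm.trans (hp 0)
  have endpoint_eq : simplexMap X τ w = simplexMap X σ (c 0) := congrArg Sigma.fst hs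
  obtain ⟨s', hs'⟩ := exists_smul_simplexPathClass_eq hx endpoint_eq.symm
  let d := PathConnectedSpace.somePath (stdSimplex.vertex (S := ℝ) (0 : Fin (n + 1))) (c 0)
  have moved : (s * s'⁻¹) • simplexPathClass hx σ (c 0) = PathsFrom.mk e := by
    rw [mul_smul, ← hs', inv_smul_smul, hs]
  rw [simplexPathClass_eq hx σ d] at moved
  refine ⟨s * s'⁻¹, n, σ, c 1, Eq.trans (congrArg _ ?_) (PathsFrom.smul_mk_trans moved p)⟩
  let path_c : Path (c 0) (c 1) := ⟨c, rfl, rfl⟩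
  rw [simplexPathClass_eq hx σ (d.trans path_c)]
  refine PathsFrom.mk_congr fun t => ?_
  rw [Path.cast_coe, Path.map_trans]
  exact path_trans_apply_congr (fun _ => rfl) (fun t => (hp t).symm) t

theorem isEdgeReachable {y : |X|} (p : Path (vertexPoint X x) y) :
    IsEdgeReachable hx (PathsFrom.mk p) := by
  let P ⦃y z : |X|⦄ (p : Path y z) : Prop := ∀ e : Path (vertexPoint X x) y,
    IsEdgeReachable hx (PathsFrom.mk e) → IsEdgeReachable hx (PathsFrom.mk (e.trans p))
  have multiplicative : IsMultiplicative P :=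
    { of_homotopic := fun y z p q hpq hp e he => by
        rw [← PathsFrom.mk_eq_mk_iff.2 ((Path.Homotopic.refl e).hcomp hpq)]
        exact hp e he
      trans := fun y z w p q hp hq e he => by
        rw [← PathsFrom.mk_eq_mk_iff.2 ⟨Path.Homotopy.transAssoc e p q⟩]
        exact hq _ (hp e he) }
  have reachable_refl : IsEdgeReachable hx (PathsFrom.mk (Path.refl (vertexPoint X x))) :=
    ⟨1, 0, x, default, by rw [one_smul, simplexPathClass_default]⟩
  rw [← PathsFrom.mk_eq_mk_iff.2 ⟨Path.Homotopy.reflTrans p⟩]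
  exact path_induction multiplicative
    (fun n σ c y z p hp e he => he.trans_simplex hx σ c p hp) p _ reachable_refl

theorem edgeSubgroup_eq_top : edgeSubgroup hx = ⊤ := by
  rw [eq_top_iff]
  intro g _
  obtain ⟨p, rfl⟩ := Pi1.mk_surjective g
  obtain ⟨s, n, σ, v, hs⟩ := isEdgeReachable hx p
  have endpoint_eq : simplexMap X σ v = simplexMap X x default := congrArg Sigma.fst hs
  obtain ⟨s', hs'⟩ := exists_smul_simplexPathClass_eq hx endpoint_eq
  rw [← hs', simplexPathClass_default, ← mul_smul, ← PathsFrom.mk_smul_mk_refl p] at hs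
  have g_eq : ((s * s' : edgeSubgroup hx) : Pi1 |X| (vertexPoint X x)) = Pi1.mk p :=
    PathsFrom.smul_mk_refl_injective hs
  exact g_eq ▸ (s * s').2

end EdgeClass

section AugmentationIdeal

open scoped Pointwise

theorem span_pow_eq_span_pow {R : Type*} [Ring R] (S : Set R) [(Ideal.span S).IsTwoSided] (k : ℕ) :
    Ideal.span S ^ k = Ideal.span (S ^ k) := by
  induction k with
  | zero => rw [pow_zero, ← Set.singleton_one, Submodule.pow_zero, Ideal.one_eq_top,
      Ideal.span_singleton_one]
  | succ k ih =>
    have : (Ideal.span (S ^ k)).IsTwoSided := ih ▸ inferInstance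
    rw [Submodule.pow_succ, ih, Ideal.span_mul_span, pow_succ]

variable {G : Type u} [Group G] {s : Set G}

theorem of_sub_one_mem_augIdeal (g : G) : MonoidAlgebra.of ℤ G g - 1 ∈ augIdeal G := by
  rw [augIdeal, RingHom.mem_ker, map_sub, MonoidAlgebra.lift_of, MonoidHom.one_apply, map_one,
    sub_self]

theorem of_sub_one_mem_span {g : G} (hg : g ∈ Subgroup.closure s) :
    MonoidAlgebra.of ℤ G g - 1 ∈ Ideal.span ((fun a => MonoidAlgebra.of ℤ G a - 1) '' s) := by
  induction hg using Subgroup.closure_induction with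
  | mem a ha => exact Ideal.subset_span ⟨a, ha, rfl⟩
  | one => rw [map_one, sub_self]; exact zero_mem _
  | mul a b _ _ ha hb =>
    have mul_sub_one_eq : MonoidAlgebra.of ℤ G (a * b) - 1 =
        MonoidAlgebra.of ℤ G a * (MonoidAlgebra.of ℤ G b - 1) + (MonoidAlgebra.of ℤ G a - 1) := by
      rw [map_mul]
      noncomm_ring
    rw [mul_sub_one_eq]
    exact add_mem (Ideal.mul_mem_left _ _ hb) ha
  | inv a _ ha =>
    have inv_sub_one_eq : MonoidAlgebra.of ℤ G a⁻¹ - 1 =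
        -(MonoidAlgebra.of ℤ G a⁻¹) * (MonoidAlgebra.of ℤ G a - 1) := by
      rw [mul_sub, neg_mul, ← map_mul, inv_mul_cancel, map_one]
      noncomm_ring
    rw [inv_sub_one_eq]
    exact Ideal.mul_mem_left _ _ ha

theorem augIdeal_eq_span (hs : Subgroup.closure s = ⊤) :
    augIdeal G = Ideal.span ((fun a => MonoidAlgebra.of ℤ G a - 1) '' s) := by
  let J : Ideal (MonoidAlgebra ℤ G) := Ideal.span ((fun a => MonoidAlgebra.of ℤ G a - 1) '' s)
  have sub_augmentation_mem (w : MonoidAlgebra ℤ G) :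
      w - algebraMap ℤ _ (MonoidAlgebra.lift ℤ ℤ G (1 : G →* ℤ) w) ∈ J := by
    induction w using MonoidAlgebra.induction_on with
    | of g =>
      rw [MonoidAlgebra.lift_of, MonoidHom.one_apply, map_one]
      exact of_sub_one_mem_span (hs ▸ Subgroup.mem_top g)
    | add a b ha hb =>
      rw [map_add, map_add, add_sub_add_comm]
      exact add_mem ha hb
    | smul r a ha =>
      rw [map_smul, smul_eq_mul, map_mul, ← Algebra.smul_def, ← smul_sub, Algebra.smul_def]
      exact Ideal.mul_mem_left _ _ ha
  refine le_antisymm (fun w hw => ?_) (Ideal.span_le.2 ?_)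
  · rw [augIdeal, RingHom.mem_ker] at hw
    simpa only [hw, map_zero, sub_zero] using sub_augmentation_mem w
  · rintro _ ⟨a, -, rfl⟩
    exact of_sub_one_mem_augIdeal a

theorem DQuot.exists_hom (hs : Subgroup.closure s = ⊤) {R : Type*} [Ring R] (ρ : G →* R) {k : ℕ}
    (hρ : ((fun a => ρ a - 1) '' s) ^ k ⊆ {0}) :
    ∃ Θ : DQuot G k →+* R, ∀ g, Θ (DQuot.of k g) = ρ g := by
  let Θ : MonoidAlgebra ℤ G →+* R := (MonoidAlgebra.lift ℤ R G ρ : MonoidAlgebra ℤ G →ₐ[ℤ] R)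
  have Θ_of (g : G) : Θ (MonoidAlgebra.of ℤ G g) = ρ g := MonoidAlgebra.lift_of _ _
  have pow_le_ker : augIdeal G ^ k ≤ RingHom.ker Θ := by
    have two_sided : (Ideal.span ((fun a => MonoidAlgebra.of ℤ G a - 1) '' s)).IsTwoSided :=
      augIdeal_eq_span hs ▸ inferInstance
    rw [augIdeal_eq_span hs, span_pow_eq_span_pow, Ideal.span_le]
    intro w hw
    have image_mem : Θ w ∈ ((fun a => ρ a - 1) '' s) ^ k := by
      have image_eq : Θ '' ((fun a => MonoidAlgebra.of ℤ G a - 1) '' s) =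
          (fun a => ρ a - 1) '' s := by
        simp only [Set.image_image, map_sub, map_one, Θ_of]
      rw [← image_eq, ← Set.image_pow]
      exact ⟨w, hw, rfl⟩
    exact hρ image_mem
  exact ⟨Ideal.Quotient.lift _ Θ pow_le_ker, Θ_of⟩

theorem DQuot.ringHom_ext (hs : Subgroup.closure s = ⊤) {R : Type*} [Ring R] {k : ℕ}
    {Θ Ψ : DQuot G k →+* R} (h : ∀ a ∈ s, Θ (DQuot.of k a) = Ψ (DQuot.of k a)) : Θ = Ψ := by
  let π := Ideal.Quotient.mk (augIdeal G ^ k)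
  have hom_eq : ((Θ.comp π : MonoidAlgebra ℤ G →* R).comp (MonoidAlgebra.of ℤ G)) =
      (Ψ.comp π : MonoidAlgebra ℤ G →* R).comp (MonoidAlgebra.of ℤ G) :=
    MonoidHom.eq_of_eqOn_dense hs h
  exact Ideal.Quotient.ringHom_ext
    (MonoidAlgebra.ringHom_ext' (Subsingleton.elim _ _) hom_eq)

end AugmentationIdeal

section CobarHomology

open scoped Pointwise

variable (X : SSet.{u})

theorem cobarD_gen_triangle (t : X _⦋2⦌) : cobarD X (gen X t) =
    (1 + gen X (X.δ 1 t)) - (1 + gen X (X.δ 2 t)) * (1 + gen X (X.δ 0 t)) := by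
  have front_eq : (frontFace X t 1 : X _⦋1⦌) = X.δ 2 t := by
    unfold frontFace SimplicialObject.δ
    congr 4
    exact SimplexCategory.Hom.ext_one_left _ _
  have back_eq : (backFace X t 1 : X _⦋1⦌) = X.δ 0 t := by
    unfold backFace SimplicialObject.δ
    congr 4
  have gen_front_one : gen X (frontFace X t 1) = gen X (X.δ 2 t) := congrArg (gen X) front_eq
  have gen_back_one : gen X (backFace X t 1) = gen X (X.δ 0 t) := congrArg (gen X) back_eq
  have gen_front_zero : gen X (frontFace X t 0) = 0 := by rw [gen, redSimplex_zero X rfl, map_zero]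
  have gen_back_two : gen X (backFace X t 2) = 0 := by rw [gen, redSimplex_zero X rfl, map_zero]
  have bracket_face (i : Fin 3) : bracket X (redSimplex X (X.δ i t)) = gen X (X.δ i t) := rfl
  rw [cobarD_gen, redBoundary_redSimplex, Fin.sum_univ_three, Fin.sum_univ_three, gen_front_zero,
    gen_back_two, gen_front_one, gen_back_one]
  simp only [map_add, map_neg, bracket_face, Fin.val_zero, Fin.val_one, Fin.val_two, pow_zero,
    pow_one, neg_one_sq, one_smul, neg_smul, zero_mul, mul_zero, smul_zero]
  noncomm_ring

theorem mem_closure_range_gen {w : Cobar X} (hw : w ∈ cobarDegree X 0) :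
    w ∈ Subring.closure (Set.range (gen X : X _⦋1⦌ → Cobar X)) := by
  induction hw using Submodule.span_induction with
  | mem w hw =>
    obtain ⟨l, hl, rfl⟩ := hw
    refine list_prod_mem fun z hz => ?_
    obtain ⟨⟨m, a⟩, hs, rfl⟩ := List.mem_map.1 hz
    obtain rfl : m = 0 := List.sum_eq_zero_iff.1 hl m (List.mem_map.2 ⟨_, hs, rfl⟩)
    exact Subring.subset_closure ⟨a, rfl⟩
  | zero => exact zero_mem _
  | add v w _ _ hv hw => exact add_mem hv hw
  | smul r w _ hw => exact zsmul_mem hw r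

theorem cobarD_eq_zero_of_mem_cobarDegree_zero {w : Cobar X} (hw : w ∈ cobarDegree X 0) :
    cobarD X w = 0 := by
  replace hw := mem_closure_range_gen X hw
  induction hw using Subring.closure_induction with
  | mem w hw =>
    obtain ⟨a, rfl⟩ := hw
    exact cobarD_gen_edge X a
  | zero => exact map_zero _
  | one => exact cobarD_one X
  | add v w _ _ hv hw => rw [map_add, hv, hw, add_zero]
  | neg w _ hw => rw [map_neg, hw, neg_zero]
  | mul v w _ _ hv hw => rw [cobarD_mul, hv, hw, zero_mul, mul_zero, add_zero]

variable (k : ℕ)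

theorem coe_oneAddEdge_sub_one (a : X _⦋1⦌) :
    ((oneAddEdge X k a - 1 : zeroCycles X k) : TruncCobar X k) = toTrunc X k (gen X a) := by
  change toTrunc X k (1 + gen X a) - 1 = _
  rw [map_add, map_one, add_sub_cancel_left]

theorem closure_range_oneAddEdge : Subring.closure (Set.range (oneAddEdge X k)) = ⊤ := by
  rw [eq_top_iff]
  rintro ⟨_, ⟨w, hw, rfl⟩, hz⟩ -
  have closure_le : Subring.closure (Set.range (gen X : X _⦋1⦌ → Cobar X)) ≤
      ((Subring.closure (Set.range (oneAddEdge X k))).map (zeroCycles X k).subtype).comap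
        (toTrunc X k) := by
    refine Subring.closure_le.2 ?_
    rintro _ ⟨a, rfl⟩
    exact ⟨oneAddEdge X k a - 1,
      sub_mem (Subring.subset_closure (Set.mem_range_self a)) (one_mem _),
      coe_oneAddEdge_sub_one X k a⟩
  obtain ⟨z, z_mem, z_eq⟩ := closure_le (mem_closure_range_gen X hw)
  obtain rfl : z = ⟨_, ⟨w, hw, rfl⟩, hz⟩ := Subtype.ext z_eq
  exact z_mem

theorem AQuot.ringHom_ext {R : Type*} [Ring R] {f g : AQuot X k →+* R}
    (h : ∀ a, f (AQuot.mk X k (oneAddEdge X k a)) = g (AQuot.mk X k (oneAddEdge X k a))) : f = g :=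
  Ideal.Quotient.ringHom_ext <|
    RingHom.eq_of_eqOn_set_dense (closure_range_oneAddEdge X k) (Set.forall_mem_range.2 h)

theorem range_gen_pow_subset_lengthIdeal :
    (Set.range (gen X : X _⦋1⦌ → Cobar X)) ^ k ⊆ lengthIdeal X k := by
  have range_subset : Set.range (gen X : X _⦋1⦌ → Cobar X) ⊆ LinearMap.range (bracket X) := by
    rintro _ ⟨a, rfl⟩
    exact ⟨_, rfl⟩
  exact (Set.pow_subset_pow_left range_subset).trans
    ((Submodule.pow_subset_pow _).trans Ideal.subset_span)

theorem range_mk_oneAddEdge_sub_one_pow_subset :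
    (Set.range fun a => AQuot.mk X k (oneAddEdge X k a) - 1) ^ k ⊆ {0} := by
  have cycle_eq_zero {z : zeroCycles X k}
      (hz : z ∈ (Set.range fun a => oneAddEdge X k a - 1) ^ k) : z = 0 := by
    have image_eq : (zeroCycles X k).subtype '' Set.range (fun a => oneAddEdge X k a - 1) =
        toTrunc X k '' Set.range (gen X : X _⦋1⦌ → Cobar X) := by
      simp only [← Set.range_comp]
      exact congrArg Set.range (funext (coe_oneAddEdge_sub_one X k))
    have coe_mem : (z : TruncCobar X k) ∈ toTrunc X k '' Set.range (gen X : X _⦋1⦌ → _) ^ k := by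
      rw [Set.image_pow, ← image_eq, ← Set.image_pow]
      exact ⟨z, hz, rfl⟩
    obtain ⟨w, hw, w_eq⟩ := coe_mem
    exact Subtype.ext (w_eq.symm.trans
      (Ideal.Quotient.eq_zero_iff_mem.2 (range_gen_pow_subset_lengthIdeal X k hw)))
  let π := Ideal.Quotient.mk (zeroBoundaries X k)
  have range_eq : (Set.range fun a => AQuot.mk X k (oneAddEdge X k a) - 1) =
      π '' Set.range fun a => oneAddEdge X k a - 1 := by
    rw [← Set.range_comp]
    rfl
  rw [range_eq, ← Set.image_pow]
  rintro _ ⟨z, hz, rfl⟩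
  rw [cycle_eq_zero hz, map_zero, Set.mem_singleton_iff]

theorem isUnit_mk_oneAddEdge (a : X _⦋1⦌) : IsUnit (AQuot.mk X k (oneAddEdge X k a)) := by
  have nilpotent : IsNilpotent (AQuot.mk X k (oneAddEdge X k a) - 1) :=
    ⟨k, range_mk_oneAddEdge_sub_one_pow_subset X k (Set.pow_mem_pow ⟨a, rfl⟩)⟩
  rw [← add_sub_cancel 1 (AQuot.mk X k _)]
  exact nilpotent.isUnit_one_add

theorem isCocycle_mk_oneAddEdge : IsCocycle fun a => AQuot.mk X k (oneAddEdge X k a) := by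
  intro t
  simp only [AQuot.mk]
  rw [← map_mul, Ideal.Quotient.eq]
  refine ⟨toTrunc X k (gen X t), toTrunc_mem X k (gen_mem_cobarDegree X t), ?_⟩
  rw [truncD_toTrunc, cobarD_gen_triangle, map_sub, map_mul]
  rfl

end CobarHomology

section CobarLift

variable {X : SSet.{u}} {R : Type*} [Ring R] (φ : X _⦋1⦌ → R)

/-- The linear map on the reduced chains which sends an edge `a` to `φ a - 1` and all the simplices
of dimension different from `1` to `0`. -/
def chainLift : RedChains X →ₗ[ℤ] R :=
  (zeroChains X).liftQ
    (Finsupp.linearCombination ℤ fun s : Σ n : ℕ, X _⦋n⦌ => match s with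
      | ⟨1, a⟩ => φ a - 1
      | ⟨_, _⟩ => 0) <| by
    refine Submodule.span_le.2 ?_
    rintro _ ⟨y, rfl⟩
    exact (Finsupp.linearCombination_single ℤ _ _).trans (one_smul ℤ _)

theorem chainLift_edge (a : X _⦋1⦌) : chainLift φ (redSimplex X a) = φ a - 1 :=
  (Finsupp.linearCombination_single ℤ _ _).trans (one_smul ℤ _)

theorem chainLift_mem {I : Ideal R} (hφ : ∀ a, φ a - 1 ∈ I) (c : RedChains X) :
    chainLift φ c ∈ I := by
  obtain ⟨c, rfl⟩ := (zeroChains X).mkQ_surjective c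
  change Finsupp.linearCombination ℤ _ c ∈ _
  rw [Finsupp.linearCombination_apply]
  refine sum_mem fun s _ => zsmul_mem ?_ _
  split
  · exact hφ _
  · exact zero_mem _

/-- The algebra homomorphism on the cobar construction with `1 + [a] ↦ φ a` for an edge `a`. -/
def cobarLift : Cobar X →ₐ[ℤ] R := TensorAlgebra.lift ℤ (chainLift φ)

theorem cobarLift_bracket (c : RedChains X) : cobarLift φ (bracket X c) = chainLift φ c :=
  TensorAlgebra.lift_ι_apply _ _

theorem cobarLift_one_add_edge (a : X _⦋1⦌) : cobarLift φ (1 + gen X a) = φ a := by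
  rw [map_add, map_one, gen, cobarLift_bracket, chainLift_edge, add_sub_cancel]

theorem cobarLift_mem_pow {I : Ideal R} [I.IsTwoSided] (hφ : ∀ a, φ a - 1 ∈ I) (k : ℕ)
    {w : Cobar X} (hw : w ∈ lengthIdeal X k) : cobarLift φ w ∈ I ^ k := by
  suffices tensors_mem : ∀ w ∈ LinearMap.range (bracket X) ^ k, cobarLift φ w ∈ I ^ k from
    (Ideal.span_le.2 tensors_mem : lengthIdeal X k ≤ (I ^ k).comap (cobarLift φ)) hw
  clear hw w
  intro w hw
  induction k generalizing w with
  | zero => rw [Submodule.pow_zero, Ideal.one_eq_top]; exact Submodule.mem_top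
  | succ k ih =>
    rw [pow_succ] at hw
    rw [Submodule.pow_succ]
    induction hw using Submodule.mul_induction_on' with
    | mem_mul_mem m hm n hn =>
      obtain ⟨c, rfl⟩ := hn
      rw [map_mul, cobarLift_bracket]
      exact Ideal.mul_mem_mul (ih m hm) (chainLift_mem φ hφ c)
    | add v _ w _ hv hw => rw [map_add]; exact add_mem hv hw

variable {φ}

theorem IsCocycle.cobarLift_cobarD_gen (hφ : IsCocycle φ) (t : X _⦋2⦌) :
    cobarLift φ (cobarD X (gen X t)) = 0 := by
  rw [cobarD_gen_triangle, map_sub, map_mul, cobarLift_one_add_edge, cobarLift_one_add_edge,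
    cobarLift_one_add_edge, hφ t, sub_self]

theorem IsCocycle.cobarLift_cobarD (hφ : IsCocycle φ) {w : Cobar X} (hw : w ∈ cobarDegree X 1) :
    cobarLift φ (cobarD X w) = 0 := by
  induction hw using Submodule.span_induction with
  | mem w hw =>
    obtain ⟨l, hl, rfl⟩ := hw
    induction l with
    | nil => simp at hl
    | cons s l ih =>
      obtain ⟨m, a⟩ := s
      simp only [List.map_cons, List.sum_cons] at hl
      rw [List.map_cons, List.prod_cons, cobarD_mul, map_add, map_mul, map_mul]
      rcases Nat.eq_zero_or_pos m with rfl | hm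
      · rw [ih (by omega), mul_zero, add_zero, cobarD_gen_edge X a, map_zero, zero_mul]
      · obtain rfl : m = 1 := by omega
        have tail_mem : (l.map fun s => gen X s.2).prod ∈ cobarDegree X 0 :=
          Submodule.subset_span ⟨l, by omega, rfl⟩
        rw [cobarD_eq_zero_of_mem_cobarDegree_zero X tail_mem, map_zero, mul_zero, add_zero,
          hφ.cobarLift_cobarD_gen a, zero_mul]
  | zero => rw [map_zero, map_zero]
  | add v w _ _ hv hw => rw [map_add, map_add, hv, hw, add_zero]
  | smul r w _ hw => rw [map_smul, map_smul, hw, smul_zero]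

theorem IsCocycle.exists_hom_AQuot (hφ : IsCocycle φ) {I : Ideal R} [I.IsTwoSided]
    (hI : ∀ a, φ a - 1 ∈ I) (k : ℕ) : ∃ Ψ : AQuot X k →+* R ⧸ I ^ k,
      ∀ a, Ψ (AQuot.mk X k (oneAddEdge X k a)) = Ideal.Quotient.mk (I ^ k) (φ a) := by
  let Ψ₀ : TruncCobar X k →+* R ⧸ I ^ k :=
    Ideal.Quotient.lift (lengthIdeal X k)
      ((Ideal.Quotient.mk (I ^ k)).comp (cobarLift φ : Cobar X →+* R)) fun w hw =>
        Ideal.Quotient.eq_zero_iff_mem.2 (cobarLift_mem_pow φ hI k hw)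
  have Ψ₀_toTrunc (w : Cobar X) :
      Ψ₀ (toTrunc X k w) = Ideal.Quotient.mk (I ^ k) (cobarLift φ w) := rfl
  have Ψ₀_boundary (z : zeroCycles X k) (hz : z ∈ zeroBoundaries X k) : Ψ₀ z = 0 := by
    obtain ⟨_, ⟨w, hw, rfl⟩, z_eq⟩ := hz
    rw [← z_eq]
    exact (Ψ₀_toTrunc (cobarD X w)).trans (by rw [hφ.cobarLift_cobarD hw, map_zero])
  refine ⟨Ideal.Quotient.lift (zeroBoundaries X k) (Ψ₀.comp (zeroCycles X k).subtype)
    Ψ₀_boundary, fun a => ?_⟩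
  exact (Ψ₀_toTrunc (1 + gen X a)).trans (by rw [cobarLift_one_add_edge])

end CobarLift

section Comparison

open scoped Pointwise

theorem exists_hom_DQuot_AQuot {X : SSet.{u}} {x : X _⦋0⦌} (hx : ∀ y : X _⦋0⦌, y = x) (k : ℕ) :
    ∃ Θ : DQuot (Pi1 |X| (vertexPoint X x)) k →+* AQuot X k,
      ∀ a, Θ (DQuot.of k (edgeClass X x hx a)) = AQuot.mk X k (oneAddEdge X k a) := by
  have unit_cocycle : IsCocycle fun a => (isUnit_mk_oneAddEdge X k a).unit :=
    fun t => Units.ext (isCocycle_mk_oneAddEdge X k t)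
  obtain ⟨Φ, hΦ⟩ := unit_cocycle.exists_hom x hx
  have Φ_edge (a : X _⦋1⦌) :
      (Units.coeHom _).comp Φ (edgeClass X x hx a) = AQuot.mk X k (oneAddEdge X k a) :=
    congrArg Units.val (hΦ a)
  have products_vanish :
      ((fun g => (Units.coeHom _).comp Φ g - 1) '' Set.range (edgeClass X x hx)) ^ k ⊆ {0} := by
    rw [← Set.range_comp]
    simpa only [Function.comp_def, Φ_edge] using range_mk_oneAddEdge_sub_one_pow_subset X k
  obtain ⟨Θ, hΘ⟩ := DQuot.exists_hom (edgeSubgroup_eq_top hx) _ products_vanish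
  exact ⟨Θ, fun a => (hΘ _).trans (Φ_edge a)⟩

theorem exists_hom_AQuot_DQuot {X : SSet.{u}} {x : X _⦋0⦌} (hx : ∀ y : X _⦋0⦌, y = x) (k : ℕ) :
    ∃ Ψ : AQuot X k →+* DQuot (Pi1 |X| (vertexPoint X x)) k,
      ∀ a, Ψ (AQuot.mk X k (oneAddEdge X k a)) = DQuot.of k (edgeClass X x hx a) := by
  have cocycle : IsCocycle fun a => MonoidAlgebra.of ℤ _ (edgeClass X x hx a) :=
    fun t => (congrArg (MonoidAlgebra.of ℤ _) (isCocycle_edgeClass hx t)).trans (map_mul _ _ _)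
  exact cocycle.exists_hom_AQuot (fun _ => of_sub_one_mem_augIdeal _) k

end Comparison

end CobarPi

end

theorem mainTheorem7 (X : SSet.{u}) (x : X _⦋0⦌) (hx : ∀ y : X _⦋0⦌, y = x) (k : ℕ) :
    ∃ e : CobarPi.DQuot (CobarPi.Pi1 |X| (CobarPi.vertexPoint X x)) k ≃+* CobarPi.AQuot X k,
      ∀ a : X _⦋1⦌,
        e (CobarPi.DQuot.of k (CobarPi.edgeClass X x hx a)) =
          CobarPi.AQuot.mk X k (CobarPi.oneAddEdge X k a) := by
  obtain ⟨Θ, hΘ⟩ := CobarPi.exists_hom_DQuot_AQuot hx k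
  obtain ⟨Ψ, hΨ⟩ := CobarPi.exists_hom_AQuot_DQuot hx k
  have Θ_comp_Ψ : Θ.comp Ψ = RingHom.id _ :=
    CobarPi.AQuot.ringHom_ext X k fun a => (congrArg Θ (hΨ a)).trans (hΘ a)
  have Ψ_comp_Θ : Ψ.comp Θ = RingHom.id _ := by
    refine CobarPi.DQuot.ringHom_ext (CobarPi.edgeSubgroup_eq_top hx) ?_
    rintro _ ⟨a, rfl⟩
    exact (congrArg Ψ (hΘ a)).trans (hΨ a)
  exact ⟨RingEquiv.ofRingHom Θ Ψ Θ_comp_Ψ Ψ_comp_Θ, hΘ⟩
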